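/- **Theorem 1.1 (Kunita).** Let $E$ and $F$ be Polish spaces, let $P$ be a transition (probability) kernel from $E$ to $E$ and $\Phi$ a transition kernel from $E$ to $F$. Let $(X_k,Y_k)_{k\in\mathbb{Z}}$ be a stationary hidden Markov model on a probability space $(\Omega,\mathcal{F},\mathbf{P})$, that is, a stationary $E\times F$-valued Markov process such that for all $n\in\mathbb{Z}$ and all Borel sets $A\subseteq E\times F$ $$\mathbf{P}[(X_n,Y_n)\in A\mid X_{n-1},Y_{n-1}]=\int \mathbf{1}_A(x,y)\,P(X_{n-1},dx)\,\Phi(x,dy)\quad\mathbf{P}\text{-a.s.},$$ and let $\mu:=\mathbf{P}[X_0\in\cdot\,]$ be its ($P$-invariant) law of the hidden state. Put $\mathcal{F}^Y_{-\infty,0}:=\sigma\{Y_k:k\le 0\}$ and $\mathcal{F}^X_{-\infty,n}:=\sigma\{X_k:k\le n\}$. Let $\mathcal{P}(E)$ be the space of probability measures on $E$. For $\nu\in\mathcal{P}(E)$ let $P_\nu$ be the probability measure $P_\nu(A)=\int \mathbf{1}_A(x,y)\,\nu(dx')\,P(x',dx)\,\Phi(x,dy)$ on $E\times F$ with coordinate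 projections $X,Y$, and let $\Pi:\mathcal{P}(E)\times F\to\mathcal{P}(E)$ be a measurable map such that, for every $\nu$, $\Pi(\nu,Y)$ is a version of the regular conditional probability $P_\nu(X\in\cdot\mid Y)$. The filter kernel $\mathsf{\Pi}$ is the transition kernel on $\mathcal{P}(E)$ given by $$\mathsf{\Pi}(\nu,A)=\int \mathbf{1}_A(\Pi(\nu,y))\,\nu(dx')\,P(x',dx)\,\Phi(x,dy)$$ (it does not depend on the choice of the version $\Pi$). A probability measure $\mathsf{m}$ on $\mathcal{P}(E)$ has barycenter $\mu$ if $\mu(A)=\int\nu(A)\,\mathsf{m}(d\nu)$ for all Borel sets $A\subseteq E$. 1. If $$\bigcap_{n\le 0}\big(\mathcal{F}^Y_{-\infty,0}\vee\mathcal{F}^X_{-\infty,n}\big)=\mathcal{F}^Y_{-\infty,0}\quad\mathbf{P}\text{-a.s.},\tag{$*$}$$ (every set of one $\sigma$-field is $\mathbf{P}$-a.s. equal to a set of the other), then there exists a unique $\mathsf{\Pi}$-invariant probability measure with barycenter $\mu$. 2. Conversely, suppose that in addition $\Phi$ possesses a transition density with respect to a $\sigma$-finite reference measure: there are a $\sigma$-finite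 measure $\varphi$ on $F$ and a measurable $g:E\times F\to[0,\infty)$ with $\Phi(x,A)=\int \mathbf{1}_A(y)\,g(x,y)\,\varphi(dy)$ for all $x\in E$ and all Borel sets $A\subseteq F$. If there exists a unique $\mathsf{\Pi}$-invariant probability measure with barycenter $\mu$, then $(*)$ holds. -/

import Mathlib

open MeasureTheory ProbabilityTheory
open scoped ENNReal NNReal

noncomputable section

namespace HMM

variable {E F G Ω : Type*} [MeasurableSpace E] [MeasurableSpace F] [MeasurableSpace G]

/-! ### σ-fields generated by the past -/

/-- `𝓕^Z_{-∞,n} = σ{Z_k : k ≤ n}`. -/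
@[reducible] def past (Z : ℤ → Ω → G) (n : ℤ) : MeasurableSpace Ω :=
  ⨆ (k : ℤ) (_ : k ≤ n), MeasurableSpace.comap (Z k) inferInstance

/-- Two σ-fields coincide almost surely: every set of one of them is a.s. equal to some set
of the other. -/
def EqAlmostSurely [MeasurableSpace Ω] (Pr : Measure Ω) (m₁ m₂ : MeasurableSpace Ω) : Prop :=
  (∀ A, MeasurableSet[m₁] A → ∃ B, MeasurableSet[m₂] B ∧ A =ᵐ[Pr] B) ∧
    (∀ B, MeasurableSet[m₂] B → ∃ A, MeasurableSet[m₁] A ∧ A =ᵐ[Pr] B)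

/-- The exchange identity: `⋂_{n ≤ 0} (𝓕^Y_{-∞,0} ∨ 𝓕^X_{-∞,n}) = 𝓕^Y_{-∞,0}` almost surely.
(The infimum of σ-fields is their intersection.) -/
def ExchangeIdentity [MeasurableSpace Ω] (Pr : Measure Ω) (X : ℤ → Ω → E) (Y : ℤ → Ω → F) :
    Prop :=
  EqAlmostSurely Pr (⨅ (n : ℤ) (_ : n ≤ 0), past Y 0 ⊔ past X n) (past Y 0)

/-! ### Stationary hidden Markov models -/

/-- The kernel `x' ↦ P(x', dx) Φ(x, dy)` from `E` to `E × F`. -/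
def stepKernel (P : Kernel E E) (Φ : Kernel E F) : Kernel E (E × F) :=
  P ⊗ₖ Kernel.prodMkLeft E Φ

instance (P : Kernel E E) (Φ : Kernel E F) [IsMarkovKernel P] [IsMarkovKernel Φ] :
    IsMarkovKernel (stepKernel P Φ) := by
  unfold stepKernel; infer_instance

/-- `(X_k, Y_k)_{k ∈ ℤ}`, defined on the probability space `(Ω, Pr)`, is a stationary hidden
Markov model with transition kernel `P` and observation kernel `Φ`. -/
structure IsStationaryHMM [MeasurableSpace Ω] (Pr : Measure Ω) (P : Kernel E E) (Φ : Kernel E F)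
    (X : ℤ → Ω → E) (Y : ℤ → Ω → F) : Prop where
  measurable_X : ∀ k, Measurable (X k)
  measurable_Y : ∀ k, Measurable (Y k)
  /-- The law of the process is invariant under time shifts. -/
  stationary : ∀ j : ℤ,
    Pr.map (fun ω (k : ℤ) => (X (k + j) ω, Y (k + j) ω)) =
      Pr.map (fun ω (k : ℤ) => (X k ω, Y k ω))
  /-- `(X_k, Y_k)` is a Markov process. -/
  markov : ∀ (n : ℤ) (A : Set (E × F)), MeasurableSet A →
    Pr⟦(fun ω => (X n ω, Y n ω)) ⁻¹' A | past (fun k ω => (X k ω, Y k ω)) (n - 1)⟧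
      =ᵐ[Pr]
    Pr⟦(fun ω => (X n ω, Y n ω)) ⁻¹' A |
      MeasurableSpace.comap (fun ω => (X (n - 1) ω, Y (n - 1) ω)) inferInstance⟧
  /-- `Pr[(X_n, Y_n) ∈ A | X_{n-1}, Y_{n-1}] = ∫ 1_A(x, y) P(X_{n-1}, dx) Φ(x, dy)`. -/
  transition : ∀ (n : ℤ) (A : Set (E × F)), MeasurableSet A →
    Pr⟦(fun ω => (X n ω, Y n ω)) ⁻¹' A |
      MeasurableSpace.comap (fun ω => (X (n - 1) ω, Y (n - 1) ω)) inferInstance⟧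
      =ᵐ[Pr]
    fun ω => (stepKernel P Φ (X (n - 1) ω)).real A

/-- `Φ` has a transition density with respect to some σ-finite reference measure. -/
def HasTransitionDensity (Φ : Kernel E F) : Prop :=
  ∃ φ : Measure F, SigmaFinite φ ∧ ∃ g : E × F → ℝ≥0, Measurable g ∧
    ∀ (x : E) (A : Set F), MeasurableSet A → Φ x A = ∫⁻ y in A, (g (x, y) : ℝ≥0∞) ∂φ

/-! ### The filter kernel -/

/-- The inclusion of the space of probability measures into the space of measures, as a kernel
`ν ↦ ν`. -/
def evalKernel (E : Type*) [MeasurableSpace E] : Kernel (ProbabilityMeasure E) E where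
  toFun ν := (ν : Measure E)
  measurable' := measurable_subtype_coe

instance : IsMarkovKernel (evalKernel E) := ⟨fun ν => ν.2⟩

/-- The kernel `ν ↦ P_ν` with `P_ν(A) = ∫ 1_A(x, y) ν(dx') P(x', dx) Φ(x, dy)`, with the two
coordinates exchanged: the observation `y` is the first coordinate, the state `x` the second. -/
def stepLaw (P : Kernel E E) (Φ : Kernel E F) : Kernel (ProbabilityMeasure E) (F × E) :=
  ((stepKernel P Φ) ∘ₖ (evalKernel E)).map Prod.swap

instance (P : Kernel E E) (Φ : Kernel E F) [IsMarkovKernel P] [IsMarkovKernel Φ] :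
    IsMarkovKernel (stepLaw P Φ) := by
  unfold stepLaw
  exact Kernel.IsMarkovKernel.map _ measurable_swap

section Filter

variable [StandardBorelSpace E] [Nonempty E] [MeasurableSpace.CountablyGenerated F]
  (P : Kernel E E) (Φ : Kernel E F) [IsMarkovKernel P] [IsMarkovKernel Φ]

/-- The filter update `Π(ν, y)`: a version, jointly measurable in `(ν, y)`, of the regular
conditional law `P_ν(X ∈ · | Y = y)` of the state given the observation. -/
def update (p : ProbabilityMeasure E × F) : ProbabilityMeasure E :=
  ⟨(stepLaw P Φ).condKernel p, inferInstance⟩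

lemma measurable_update : Measurable (update P Φ) :=
  (Kernel.measurable (stepLaw P Φ).condKernel).subtype_mk

/-- The transition kernel of the nonlinear filter,
`𝖯𝗂(ν, A) = ∫ 1_A(Π(ν, y)) ν(dx') P(x', dx) Φ(x, dy)`: under `𝖯𝗂(ν, ·)` the new state is
`Π(ν, y)`, where `y` has the law of the observation under `P_ν`. -/
def filterKernel : Kernel (ProbabilityMeasure E) (ProbabilityMeasure E) :=
  (Kernel.id ×ₖ (stepLaw P Φ).fst).map (update P Φ)

end Filter

/-- The probability measure `m` on the space of probability measures on `E` has barycenter `μ`: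
`μ(A) = ∫ ν(A) m(dν)` for all measurable `A`. -/
def HasBarycenter (m : Measure (ProbabilityMeasure E)) (μ : Measure E) : Prop :=
  ∀ A : Set E, MeasurableSet A → μ A = ∫⁻ ν : ProbabilityMeasure E, (ν : Measure E) A ∂m

end HMM

end

/-!
Filters are handled through *conditional laws*: `IsCondLaw Pr m Z ν` says that the random
probability measure `ν` is a version of the law of `Z` given the σ-field `m`. On the path space of
the stationary model, let `ν₀` be the conditional law of `X 0` given the past of the observations.
By the Markov property and Bayes' rule, the update map `Π` turns the filter at time `0` and the
observation `Y 1` into the filter at time `1` (`IsCondLaw.update`), and this step has the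
transition kernel `filterKernel P Φ` (`IsCondLaw.map_update`). By stationarity, the law of `ν₀` is
therefore invariant, with barycenter `μ` (`IsStationaryHMM.invariant_past`).

*Uniqueness.* Let `m` be invariant with barycenter `μ`. Because of the barycenter, a random
element `ν` of law `m` can be coupled with the model so that `ν` is the conditional law of
`X (-n)` given `ν`, and `ν` is independent of the rest of the path given `X (-n)`. The filter run
from `ν` along the observations `Y (-n+1), …, Y 0` is the conditional law of `X 0` given `ν` and
these observations, and it has law `m` by invariance. Hence it is squeezed, as a martingale,
between the conditional laws of `X 0` given these observations alone and given `ν`, all `Y k` with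
`k ≤ 0` and all `X k` with `k ≤ -n`; in the last one `ν` may be dropped, by conditional
independence. Under the exchange identity the second moments of the two bounds have the same
limit, so by Pythagoras' theorem `m` is the limit of the laws of the first one, which do not
involve `m` (`norm_charFunDual_sub_le_of_invariant`, `IsStationaryHMM.eq_of_invariant`).

*Converse.* The left-hand side of the exchange identity is a tail σ-field; let `ν₁` be the
conditional law of `X 0` given it. Under a product measure, intersecting a decreasing sequence of
σ-fields commutes, up to null sets, with joining the σ-field of the second coordinate.
When `Φ` has a density, the joint law of the past and a new observation is dominated by a product
measure, so the new observation may be joined in the same way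
(`exists_ae_eq_of_measurableSet_iInf_sup`). Hence the tail σ-field at time `1` is the one at time
`0` joined with `Y 1`, the filter recursion applies to `ν₁`, and its law is invariant as well
(`IsStationaryHMM.invariant_tailField`). If the invariant law is unique, `ν₀` and `ν₁` have the
same law; their σ-fields being nested, equality of second moments forces `ν₀ = ν₁` almost surely
(`IsCondLaw.ae_eq_of_map_eq`). Thus, at every time, the state is independent of the tail σ-field
given the observations, and by the Markov property so are all later states and observations. As a
tail event is measurable with respect to these in the limit, it is conditionally independent of
itself, that is, an event of the observations (`IsStationaryHMM.exchangeIdentity`).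
-/

open Filter Topology

namespace HMM

/-! ### Generation of suprema and infima of σ-fields -/

section Generation

variable {Ω Ω' : Type*}

lemma sup_eq_generateFrom (m₁ m₂ : MeasurableSpace Ω) :
    m₁ ⊔ m₂ = MeasurableSpace.generateFrom
      {S | ∃ A B, MeasurableSet[m₁] A ∧ MeasurableSet[m₂] B ∧ S = A ∩ B} := by
  apply le_antisymm
  · refine sup_le ?_ ?_
    · intro A hA
      exact MeasurableSpace.measurableSet_generateFrom
        ⟨A, Set.univ, hA, MeasurableSet.univ, (Set.inter_univ A).symm⟩
    · intro B hB
      exact MeasurableSpace.measurableSet_generateFrom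
        ⟨Set.univ, B, MeasurableSet.univ, hB, (Set.univ_inter B).symm⟩
  · refine MeasurableSpace.generateFrom_le ?_
    rintro S ⟨A, B, hA, hB, rfl⟩
    exact MeasurableSet.inter ((le_sup_left : m₁ ≤ m₁ ⊔ m₂) A hA)
      ((le_sup_right : m₂ ≤ m₁ ⊔ m₂) B hB)

/-- Two finite measures that agree on the intersections `A ∩ B` with `A ∈ m₁`, `B ∈ m₂` agree on
`m₁ ⊔ m₂`. -/
lemma measure_eq_of_forall_inter {mΩ : MeasurableSpace Ω} {μ ν : Measure Ω} [IsFiniteMeasure μ]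
    {m₁ m₂ : MeasurableSpace Ω} (h₁ : m₁ ≤ mΩ) (h₂ : m₂ ≤ mΩ)
    (h : ∀ A B, MeasurableSet[m₁] A → MeasurableSet[m₂] B → μ (A ∩ B) = ν (A ∩ B))
    {S : Set Ω} (hS : MeasurableSet[m₁ ⊔ m₂] S) : μ S = ν S := by
  refine ext_on_measurableSpace_of_generate_finite mΩ _ ?_ (sup_le h₁ h₂)
    (sup_eq_generateFrom m₁ m₂) ?_ ?_ hS
  · rintro S ⟨A, B, hA, hB, rfl⟩
    exact h A B hA hB
  · rintro _ ⟨A, B, hA, hB, rfl⟩ _ ⟨A', B', hA', hB', rfl⟩ -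
    exact ⟨A ∩ A', B ∩ B', hA.inter hA', hB.inter hB', Set.inter_inter_inter_comm A B A' B'⟩
  · simpa using h Set.univ Set.univ MeasurableSet.univ MeasurableSet.univ

/-- Two finite measures that agree on every member of a monotone sequence of σ-fields agree on
its supremum. -/
lemma measure_eq_of_forall_iSup {mΩ : MeasurableSpace Ω} {μ ν : Measure Ω} [IsFiniteMeasure μ]
    {m : ℕ → MeasurableSpace Ω} (hm : Monotone m) (hle : ∀ n, m n ≤ mΩ)
    (h : ∀ n A, MeasurableSet[m n] A → μ A = ν A)
    {S : Set Ω} (hS : MeasurableSet[⨆ n, m n] S) : μ S = ν S := by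
  refine ext_on_measurableSpace_of_generate_finite mΩ (⋃ n, {A | MeasurableSet[m n] A}) ?_
    (iSup_le hle) ?_ ?_ (h 0 _ MeasurableSet.univ) hS
  · intro A hA
    obtain ⟨n, hn⟩ := Set.mem_iUnion.1 hA
    exact h n A hn
  · exact (MeasurableSpace.generateFrom_iUnion_measurableSet m).symm
  · exact isPiSystem_iUnion_of_monotone _ (fun n => @MeasurableSpace.isPiSystem_measurableSet _ (m n))
      (fun i j hij A hA => hm hij A hA)

/-- Measures that agree on a sub-σ-field give the same integral to every function measurable with
respect to it. -/
lemma lintegral_eq_of_forall_measurableSet {mΩ : MeasurableSpace Ω} {μ ν : Measure Ω}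
    {m : MeasurableSpace Ω} (hm : m ≤ mΩ) (h : ∀ A, MeasurableSet[m] A → μ A = ν A)
    {f : Ω → ℝ≥0∞} (hf : Measurable[m] f) : ∫⁻ ω, f ω ∂μ = ∫⁻ ω, f ω ∂ν := by
  rw [← lintegral_trim hm hf, ← lintegral_trim hm hf]
  congr 1
  refine @Measure.ext _ m _ _ fun A hA => ?_
  rw [trim_measurableSet_eq hm hA, trim_measurableSet_eq hm hA, h A hA]

/-- A tail set of a sequence `A n ∈ m n`, with `m` antitone, belongs to all the `m n`. -/
lemma measurableSet_iInf_limsup {m : ℕ → MeasurableSpace Ω} (hm : Antitone m) {A : ℕ → Set Ω}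
    (hA : ∀ n, MeasurableSet[m n] (A n)) : MeasurableSet[⨅ n, m n] (limsup A atTop) := by
  rw [MeasurableSpace.measurableSet_iInf]
  intro k
  rw [← limsup_nat_add A k]
  exact @MeasurableSet.measurableSet_limsup _ (m k) _
    fun n => hm (Nat.le_add_left k n) _ (hA (n + k))

lemma preimage_limsup (T : Ω → Ω') (A : ℕ → Set Ω') :
    T ⁻¹' (limsup A atTop) = limsup (fun n => T ⁻¹' (A n)) atTop := by
  simp only [limsup_eq_iInf_iSup_of_nat, Set.iInf_eq_iInter, Set.iSup_eq_iUnion,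
    Set.preimage_iInter, Set.preimage_iUnion]

/-- Inverse images commute with the intersection of a decreasing sequence of σ-fields, whether or
not the map is surjective: if `A = T⁻¹(B n)` for all `n`, then `A = T⁻¹(limsup B)`. -/
lemma comap_iInf_of_antitone {m : ℕ → MeasurableSpace Ω'} (hm : Antitone m) (T : Ω → Ω') :
    (⨅ n, m n).comap T = ⨅ n, (m n).comap T := by
  apply le_antisymm
  · exact le_iInf fun n => MeasurableSpace.comap_mono (iInf_le m n)
  · intro A hA
    rw [MeasurableSpace.measurableSet_iInf] at hA
    choose B hB hBA using hA
    refine ⟨limsup B atTop, measurableSet_iInf_limsup hm hB, ?_⟩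
    rw [preimage_limsup]
    simp only [hBA, limsup_const]

end Generation

/-! ### Conditional laws -/

section CondLaw

variable {Ω Ω' E : Type*} [MeasurableSpace E]

/-- `ν` is a version of the regular conditional law of `Z` given the σ-field `m` under `Pr`: an
`m`-measurable random probability measure with `Pr(B ∩ {Z ∈ D}) = ∫_B ν(D) dPr` for `B ∈ m`. -/
structure IsCondLaw {mΩ : MeasurableSpace Ω} (Pr : Measure Ω) (m : MeasurableSpace Ω) (Z : Ω → E)
    (ν : Ω → ProbabilityMeasure E) : Prop where
  measurable : Measurable[m] ν
  measure_inter : ∀ B D, MeasurableSet[m] B → MeasurableSet D →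
    Pr (B ∩ Z ⁻¹' D) = ∫⁻ ω in B, (ν ω : Measure E) D ∂Pr

lemma measurable_eval_measure {m : MeasurableSpace Ω} {ν : Ω → ProbabilityMeasure E}
    (hν : Measurable[m] ν) {D : Set E} (hD : MeasurableSet D) :
    Measurable[m] fun ω => (ν ω : Measure E) D :=
  (Measure.measurable_coe hD).comp (measurable_subtype_coe.comp hν)

lemma exists_isCondLaw [StandardBorelSpace E] [Nonempty E] {m mΩ : MeasurableSpace Ω}
    (Pr : Measure Ω) [IsFiniteMeasure Pr] (hm : m ≤ mΩ) {Z : Ω → E} (hZ : Measurable Z) :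
    ∃ ν, IsCondLaw Pr m Z ν := by
  let κ : @Kernel Ω E m _ := @condDistrib Ω Ω E _ _ _ mΩ m Z id Pr _
  have hκ : IsMarkovKernel κ := by dsimp only [κ]; infer_instance
  refine ⟨fun ω => ⟨κ ω, inferInstance⟩, ?_, ?_⟩
  · exact (Kernel.measurable κ).subtype_mk
  · intro B D hB hD
    exact (@setLIntegral_preimage_condDistrib Ω Ω E _ _ _ mΩ Pr _ id Z m D B
      (measurable_id'' hm) hZ.aemeasurable hD hB).symm

lemma IsCondLaw.comap {mΩ : MeasurableSpace Ω} {m mΩ' : MeasurableSpace Ω'} {Pr : Measure Ω}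
    {Pr' : Measure Ω'} (hm : m ≤ mΩ') {Z : Ω' → E} {ν : Ω' → ProbabilityMeasure E} (h : IsCondLaw Pr' m Z ν)
    {T : Ω → Ω'} (hT : MeasurePreserving T Pr Pr') (hZ : Measurable Z) :
    IsCondLaw Pr (m.comap T) (Z ∘ T) (ν ∘ T) := by
  refine ⟨h.measurable.comp (comap_measurable T), ?_⟩
  rintro _ D ⟨B, hB, rfl⟩ hD
  have := hT.measure_preimage ((hm B hB).inter (hZ hD)).nullMeasurableSet
  rw [Set.preimage_comp, ← Set.preimage_inter, this, h.measure_inter B D hB hD]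
  exact (hT.setLIntegral_comp_preimage (hm B hB)
    (measurable_eval_measure (h.measurable.mono hm le_rfl) hD)).symm

variable {m mΩ : MeasurableSpace Ω} {Pr : Measure Ω} {Z : Ω → E} {ν : Ω → ProbabilityMeasure E}

/-- The law of `(ω, Z ω)` integrates as the conditional law prescribes, on functions whose
dependence on `ω` is `m`-measurable. -/
lemma IsCondLaw.lintegral_prod [IsFiniteMeasure Pr] (h : IsCondLaw Pr m Z ν) (hm : m ≤ mΩ)
    (hZ : Measurable Z) {f : Ω × E → ℝ≥0∞} (hf : Measurable[m.prod inferInstance] f) :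
    ∫⁻ ω, f (ω, Z ω) ∂Pr = ∫⁻ ω, ∫⁻ z, f (ω, z) ∂(ν ω : Measure E) ∂Pr := by
  let κ : Kernel Ω E := ⟨fun ω => (ν ω : Measure E),
    measurable_subtype_coe.comp (h.measurable.mono hm le_rfl)⟩
  have hκ : IsMarkovKernel κ := ⟨fun ω => (ν ω).2⟩
  have hprod : m.prod (inferInstance : MeasurableSpace E) ≤ mΩ.prod inferInstance :=
    sup_le_sup (MeasurableSpace.comap_mono hm) le_rfl
  have hpair : Measurable fun ω => (ω, Z ω) := measurable_id.prodMk hZ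
  have key : ∀ S, MeasurableSet[m.prod inferInstance] S →
      Pr.map (fun ω => (ω, Z ω)) S = (Pr ⊗ₘ κ) S := by
    intro S hS
    refine measure_eq_of_forall_inter (m₁ := m.comap Prod.fst)
      (m₂ := MeasurableSpace.comap Prod.snd inferInstance)
      (le_trans (MeasurableSpace.comap_mono hm) le_sup_left) le_sup_right ?_ hS
    rintro _ _ ⟨B, hB, rfl⟩ ⟨D, hD, rfl⟩
    rw [← Set.prod_eq, Measure.compProd_apply_prod (hm B hB) hD,
      Measure.map_apply hpair ((hm B hB).prod hD)]
    exact h.measure_inter B D hB hD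
  have hf' : Measurable f := hf.mono hprod le_rfl
  rw [← lintegral_map hf' hpair, lintegral_eq_of_forall_measurableSet hprod key hf]
  exact Measure.lintegral_compProd hf'

lemma IsCondLaw.setLIntegral [IsFiniteMeasure Pr] (h : IsCondLaw Pr m Z ν) (hm : m ≤ mΩ)
    (hZ : Measurable Z) {f : E → ℝ≥0∞} (hf : Measurable f) {B : Set Ω} (hB : MeasurableSet[m] B) :
    ∫⁻ ω in B, f (Z ω) ∂Pr = ∫⁻ ω in B, ∫⁻ z, f z ∂(ν ω : Measure E) ∂Pr := by
  rw [← lintegral_indicator (hm B hB), ← lintegral_indicator (hm B hB)]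
  have hg : Measurable[m.prod inferInstance]
      fun p : Ω × E => (B.indicator 1 p.1 : ℝ≥0∞) * f p.2 :=
    Measurable.mul ((Measurable.indicator (@measurable_const _ _ _ m 1) hB).comp
      (@measurable_fst _ _ m _))
      (hf.comp (@measurable_snd _ _ m _))
  have := h.lintegral_prod hm hZ hg
  convert this using 3 with ω ω
  · by_cases hω : ω ∈ B <;> simp [hω]
  · by_cases hω : ω ∈ B <;> simp [hω]

/-- The defining property of the conditional law, tested on functions instead of sets. -/
lemma IsCondLaw.lintegral_mul [IsFiniteMeasure Pr] (h : IsCondLaw Pr m Z ν) (hm : m ≤ mΩ)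
    (hZ : Measurable Z) {f : Ω → ℝ≥0∞} (hf : Measurable[m] f) {D : Set E} (hD : MeasurableSet D) :
    ∫⁻ ω in Z ⁻¹' D, f ω ∂Pr = ∫⁻ ω, f ω * (ν ω : Measure E) D ∂Pr := by
  have hg : Measurable[m.prod inferInstance]
      fun p : Ω × E => f p.1 * (D.indicator 1 p.2 : ℝ≥0∞) :=
    Measurable.mul (hf.comp (@measurable_fst _ _ m _))
      ((measurable_one.indicator hD).comp (@measurable_snd _ _ m _))
  have := h.lintegral_prod hm hZ hg
  rw [← lintegral_indicator (hZ hD)]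
  convert this using 3 with ω ω
  · by_cases hω : Z ω ∈ D <;> simp [hω]
  · dsimp only
    rw [lintegral_const_mul _ (measurable_one.indicator hD), lintegral_indicator_one hD]

lemma IsCondLaw.ae_eq_condExp [IsFiniteMeasure Pr] (h : IsCondLaw Pr m Z ν) (hm : m ≤ mΩ)
    (hZ : Measurable Z) {D : Set E} (hD : MeasurableSet D) :
    (fun ω => (ν ω : Measure E).real D) =ᵐ[Pr] Pr⟦Z ⁻¹' D | m⟧ := by
  have hmeas : Measurable[m] fun ω => (ν ω : Measure E).real D :=
    (measurable_eval_measure h.measurable hD).ennreal_toReal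
  have hint : Integrable (fun ω => (ν ω : Measure E).real D) Pr := by
    refine Integrable.of_bound (hmeas.mono hm le_rfl).aestronglyMeasurable 1 (ae_of_all _ fun ω => ?_)
    rw [Real.norm_of_nonneg measureReal_nonneg]
    exact measureReal_le_one
  refine ae_eq_condExp_of_forall_setIntegral_eq hm
    ((integrable_const (1 : ℝ)).indicator (hZ hD)) (fun B _ _ => hint.integrableOn) ?_
    hmeas.stronglyMeasurable.aestronglyMeasurable
  intro B hB _
  rw [integral_indicator (hZ hD), setIntegral_const, smul_eq_mul, mul_one,
    measureReal_restrict_apply (hZ hD)]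
  rw [Set.inter_comm, measureReal_def, h.measure_inter B D hB hD]
  rw [← integral_toReal]
  · rfl
  · exact (measurable_eval_measure (h.measurable.mono hm le_rfl) hD).aemeasurable
  · exact ae_of_all _ fun ω => measure_lt_top _ _

end CondLaw

/-! ### Convergence of conditional probabilities -/

section Convergence

variable {Ω : Type*} {mΩ : MeasurableSpace Ω} {μ : Measure Ω}

/-- Orthogonal projections onto a decreasing sequence of subspaces converge strongly to the
projection onto the intersection; the dual of `Submodule.starProjection_tendsto_closure_iSup`. -/
lemma tendsto_starProjection_iInf {H : Type*} [NormedAddCommGroup H] [InnerProductSpace ℝ H]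
    [CompleteSpace H] (U : ℕ → Submodule ℝ H) [∀ n, (U n).HasOrthogonalProjection]
    [(⨅ n, U n).HasOrthogonalProjection] (hU : Antitone U) (x : H) :
    Tendsto (fun n => (U n).starProjection x) atTop (𝓝 ((⨅ n, U n).starProjection x)) := by
  have h := Submodule.starProjection_tendsto_closure_iSup (fun n => (U n)ᗮ)
    (fun i j hij => Submodule.orthogonal_le (hU hij)) x
  have hsup : (⨆ n, (U n)ᗮ).topologicalClosure = (⨅ n, U n)ᗮ := by
    rw [← Submodule.orthogonal_orthogonal_eq_closure, ← Submodule.iInf_orthogonal]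
    simp only [Submodule.orthogonal_orthogonal]
  have h' : Tendsto (fun n => x - (U n)ᗮ.starProjection x) atTop
      (𝓝 (x - (⨅ n, U n)ᗮ.starProjection x)) := by
    simp only [hsup] at h
    exact tendsto_const_nhds.sub h
  simpa only [Submodule.starProjection_orthogonal_val, sub_sub_cancel] using h'

/-- A function that has versions measurable with respect to every member of a decreasing sequence
of σ-fields has a version measurable with respect to the intersection: the upper limit of those
versions. -/
lemma aestronglyMeasurable_iInf {m : ℕ → MeasurableSpace Ω} (hm : Antitone m) {f : Ω → ℝ}
    (hf : ∀ n, AEStronglyMeasurable[m n] f μ) : AEStronglyMeasurable[⨅ n, m n] f μ := by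
  choose g hg hfg using hf
  refine ⟨fun ω => limsup (fun n => g n ω) atTop, Measurable.stronglyMeasurable ?_, ?_⟩
  · have key : ∀ k, Measurable[m k] fun ω => limsup (fun n => g n ω) atTop := by
      intro k
      have : (fun ω => limsup (fun n => g n ω) atTop)
          = fun ω => limsup (fun n => g (n + k) ω) atTop := by
        funext ω
        exact (limsup_nat_add (fun n => g n ω) k).symm
      rw [this]
      exact @Measurable.limsup _ _ _ _ _ (m k) _ _ _ _
        fun n => (hg (n + k)).measurable.mono (hm (Nat.le_add_left k n)) le_rfl
    intro A hA
    rw [MeasurableSpace.measurableSet_iInf]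
    exact fun k => key k hA
  · filter_upwards [ae_all_iff.2 hfg] with ω hω
    simp only [← hω, limsup_const]

/-- Downward convergence of conditional expectations. The orthogonal projections converge in `L²`,
which suffices for `L¹` convergence. -/
lemma tendsto_eLpNorm_condExp_iInf [IsProbabilityMeasure μ] {m : ℕ → MeasurableSpace Ω}
    (hm : Antitone m) (hle : ∀ n, m n ≤ mΩ) {f : Ω → ℝ} (hf : MemLp f 2 μ) :
    Tendsto (fun n => eLpNorm (μ[f | m n] - μ[f | ⨅ n, m n]) 1 μ) atTop (𝓝 0) := by
  have hle' : ⨅ n, m n ≤ mΩ := (iInf_le m 0).trans (hle 0)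
  have : ∀ n, Fact (m n ≤ mΩ) := fun n => ⟨hle n⟩
  have : Fact (⨅ n, m n ≤ mΩ) := ⟨hle'⟩
  have hU : ⨅ n, lpMeas ℝ ℝ (m n) 2 μ = lpMeas ℝ ℝ (⨅ n, m n) 2 μ := by
    ext g
    simp only [Submodule.mem_iInf, mem_lpMeas_iff_aestronglyMeasurable]
    exact ⟨fun h => aestronglyMeasurable_iInf hm h, fun h n => h.mono (iInf_le m n)⟩
  have : (⨅ n, lpMeas ℝ ℝ (m n) 2 μ).HasOrthogonalProjection := by rw [hU]; infer_instance
  have hanti : Antitone fun n => lpMeas ℝ ℝ (m n) 2 μ := by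
    intro i j hij g hg
    rw [mem_lpMeas_iff_aestronglyMeasurable] at hg ⊢
    exact hg.mono (hm hij)
  have h := tendsto_starProjection_iInf _ hanti (hf.toLp f)
  simp only [hU] at h
  rw [Lp.tendsto_Lp_iff_tendsto_eLpNorm'] at h
  have hproj : ∀ n, ((lpMeas ℝ ℝ (m n) 2 μ).starProjection (hf.toLp f) : Ω → ℝ) =ᵐ[μ] μ[f | m n] :=
    fun n => hf.condExpL2_ae_eq_condExp (𝕜 := ℝ) (hle n)
  have hproj' : ((lpMeas ℝ ℝ (⨅ n, m n) 2 μ).starProjection (hf.toLp f) : Ω → ℝ) =ᵐ[μ]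
      μ[f | ⨅ n, m n] := hf.condExpL2_ae_eq_condExp (𝕜 := ℝ) hle'
  refine tendsto_of_tendsto_of_tendsto_of_le_of_le tendsto_const_nhds h (fun _ => bot_le) ?_
  intro n
  have hae := (hproj n).sub hproj'
  dsimp only
  rw [← eLpNorm_congr_ae hae]
  exact eLpNorm_le_eLpNorm_of_exponent_le one_le_two
    ((Lp.aestronglyMeasurable _).sub (Lp.aestronglyMeasurable _))

lemma condExp_indicator_mem_Icc [IsFiniteMeasure μ] {m : MeasurableSpace Ω} (hm : m ≤ mΩ) {S : Set Ω}
    (hS : MeasurableSet[mΩ] S) : ∀ᵐ ω ∂μ, (μ⟦S | m⟧) ω ∈ Set.Icc (0 : ℝ) 1 := by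
  have h0 : 0 ≤ᵐ[μ] μ⟦S | m⟧ :=
    condExp_nonneg (ae_of_all _ fun ω => Set.indicator_nonneg (fun _ _ => zero_le_one) ω)
  have h1 : μ⟦S | m⟧ ≤ᵐ[μ] μ[fun _ => (1 : ℝ) | m] :=
    condExp_mono ((integrable_const (1 : ℝ)).indicator hS) (integrable_const 1)
      (ae_of_all _ fun ω => Set.indicator_le_self' (fun _ _ => zero_le_one) ω)
  rw [condExp_const hm] at h1
  filter_upwards [h0, h1] with ω h0 h1 using ⟨h0, h1⟩

/-- Conditional probabilities that converge in `L¹` have converging second moments. -/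
lemma tendsto_integral_sq_condExp [IsFiniteMeasure μ] {m : ℕ → MeasurableSpace Ω}
    {m' : MeasurableSpace Ω} (hle : ∀ n, m n ≤ mΩ) (hle' : m' ≤ mΩ) {S : Set Ω}
    (hS : MeasurableSet[mΩ] S)
    (h : Tendsto (fun n => eLpNorm (μ⟦S | m n⟧ - μ⟦S | m'⟧) 1 μ) atTop (𝓝 0)) :
    Tendsto (fun n => ∫ ω, (μ⟦S | m n⟧) ω ^ 2 ∂μ) atTop (𝓝 (∫ ω, (μ⟦S | m'⟧) ω ^ 2 ∂μ)) := by
  have hsq : ∀ {m : MeasurableSpace Ω}, m ≤ mΩ → Integrable (fun ω => (μ⟦S | m⟧) ω ^ 2) μ := by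
    intro m hm
    refine Integrable.of_bound (integrable_condExp.aestronglyMeasurable.pow 2) 1 ?_
    filter_upwards [condExp_indicator_mem_Icc (μ := μ) hm hS] with ω hω
    rw [Real.norm_of_nonneg (sq_nonneg _)]
    exact pow_le_one₀ hω.1 hω.2
  have hL : Tendsto (fun n => 2 * ∫ ω, ‖(μ⟦S | m n⟧ - μ⟦S | m'⟧) ω‖ ∂μ) atTop (𝓝 0) := by
    have h1 := ((ENNReal.tendsto_toReal ENNReal.zero_ne_top).comp h).const_mul 2
    simp only [ENNReal.toReal_zero, mul_zero] at h1
    refine h1.congr fun n => ?_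
    rw [Function.comp_apply, eLpNorm_one_eq_lintegral_enorm,
      integral_norm_eq_lintegral_enorm (integrable_condExp.sub integrable_condExp).1]
  rw [tendsto_iff_norm_sub_tendsto_zero]
  refine squeeze_zero (fun _ => norm_nonneg _) (fun n => ?_) hL
  rw [← integral_sub (hsq (hle n)) (hsq hle'), ← integral_const_mul]
  refine (norm_integral_le_integral_norm _).trans (integral_mono_ae
    ((hsq (hle n)).sub (hsq hle')).norm
    ((integrable_condExp.sub integrable_condExp).norm.const_mul 2) ?_)
  filter_upwards [condExp_indicator_mem_Icc (μ := μ) (hle n) hS,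
    condExp_indicator_mem_Icc (μ := μ) hle' hS] with ω h1 h2
  have : (μ⟦S | m n⟧) ω ^ 2 - (μ⟦S | m'⟧) ω ^ 2
      = ((μ⟦S | m n⟧) ω + (μ⟦S | m'⟧) ω) * ((μ⟦S | m n⟧) ω - (μ⟦S | m'⟧) ω) := by ring
  rw [this, norm_mul, Pi.sub_apply]
  refine mul_le_mul_of_nonneg_right ?_ (norm_nonneg _)
  rw [Real.norm_of_nonneg (add_nonneg h1.1 h2.1)]
  linarith [h1.2, h2.2]

end Convergence

section SecondMoment

variable {Ω E : Type*} [MeasurableSpace E] {m₁ m₂ mΩ : MeasurableSpace Ω} {Pr : Measure Ω}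
  [IsProbabilityMeasure Pr] {Z : Ω → E} {ν₁ ν₂ : Ω → ProbabilityMeasure E}

lemma integrable_mul_measureReal (h₁ : Measurable ν₁) (h₂ : Measurable ν₂) {D : Set E}
    (hD : MeasurableSet D) :
    Integrable (fun ω => (ν₁ ω : Measure E).real D * (ν₂ ω : Measure E).real D) Pr := by
  refine Integrable.of_bound ((measurable_eval_measure h₁ hD).ennreal_toReal.mul
    (measurable_eval_measure h₂ hD).ennreal_toReal).aestronglyMeasurable 1 (ae_of_all _ fun ω => ?_)
  rw [Real.norm_of_nonneg (mul_nonneg measureReal_nonneg measureReal_nonneg)]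
  exact mul_le_one₀ measureReal_le_one measureReal_nonneg measureReal_le_one

lemma memLp_measureReal_sub (h₁ : Measurable ν₁) (h₂ : Measurable ν₂) {D : Set E}
    (hD : MeasurableSet D) :
    MemLp (fun ω => (ν₂ ω : Measure E).real D - (ν₁ ω : Measure E).real D) 2 Pr := by
  refine MemLp.of_bound ((measurable_eval_measure h₂ hD).ennreal_toReal.sub
    (measurable_eval_measure h₁ hD).ennreal_toReal).aestronglyMeasurable 1
    (ae_of_all _ fun ω => ?_)
  have h1 : (ν₂ ω : Measure E).real D ≤ 1 := measureReal_le_one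
  have h2 : (ν₁ ω : Measure E).real D ≤ 1 := measureReal_le_one
  have h3 : 0 ≤ (ν₂ ω : Measure E).real D := measureReal_nonneg
  have h4 : 0 ≤ (ν₁ ω : Measure E).real D := measureReal_nonneg
  rw [Real.norm_eq_abs, abs_le]
  constructor <;> linarith

/-- Pythagoras' theorem for the conditional probabilities given two nested σ-fields. -/
lemma IsCondLaw.integral_sq_sub (h₁ : IsCondLaw Pr m₁ Z ν₁) (h₂ : IsCondLaw Pr m₂ Z ν₂)
    (hm : m₁ ≤ m₂) (hm₂ : m₂ ≤ mΩ) (hZ : Measurable Z) {D : Set E} (hD : MeasurableSet D) :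
    ∫ ω, ((ν₂ ω : Measure E).real D - (ν₁ ω : Measure E).real D) ^ 2 ∂Pr =
      ∫ ω, (ν₂ ω : Measure E).real D ^ 2 ∂Pr - ∫ ω, (ν₁ ω : Measure E).real D ^ 2 ∂Pr := by
  have hν₁ : Measurable ν₁ := h₁.measurable.mono (hm.trans hm₂) le_rfl
  have hν₂ : Measurable ν₂ := h₂.measurable.mono hm₂ le_rfl
  have hcross : ∫ ω, (ν₁ ω : Measure E).real D * (ν₂ ω : Measure E).real D ∂Pr
      = ∫ ω, (ν₁ ω : Measure E).real D * (ν₁ ω : Measure E).real D ∂Pr := by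
    have hlin : ∫⁻ ω, (ν₁ ω : Measure E) D * (ν₂ ω : Measure E) D ∂Pr
        = ∫⁻ ω, (ν₁ ω : Measure E) D * (ν₁ ω : Measure E) D ∂Pr := by
      rw [← h₂.lintegral_mul hm₂ hZ ((measurable_eval_measure h₁.measurable hD).mono hm le_rfl) hD,
        ← h₁.lintegral_mul (hm.trans hm₂) hZ (measurable_eval_measure h₁.measurable hD) hD]
    simp only [measureReal_def, ← ENNReal.toReal_mul]
    rw [integral_toReal, integral_toReal, hlin]
    · exact ((measurable_eval_measure hν₁ hD).mul (measurable_eval_measure hν₁ hD)).aemeasurable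
    · exact ae_of_all _ fun ω => ENNReal.mul_lt_top (measure_lt_top _ _) (measure_lt_top _ _)
    · exact ((measurable_eval_measure hν₁ hD).mul (measurable_eval_measure hν₂ hD)).aemeasurable
    · exact ae_of_all _ fun ω => ENNReal.mul_lt_top (measure_lt_top _ _) (measure_lt_top _ _)
  have h11 := integrable_mul_measureReal (Pr := Pr) hν₁ hν₁ hD
  have h12 := integrable_mul_measureReal (Pr := Pr) hν₁ hν₂ hD
  have h22 := integrable_mul_measureReal (Pr := Pr) hν₂ hν₂ hD
  have hexp : ∀ ω, ((ν₂ ω : Measure E).real D - (ν₁ ω : Measure E).real D) ^ 2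
      = ((ν₂ ω : Measure E).real D * (ν₂ ω : Measure E).real D
        - 2 * ((ν₁ ω : Measure E).real D * (ν₂ ω : Measure E).real D))
        + (ν₁ ω : Measure E).real D * (ν₁ ω : Measure E).real D := fun ω => by ring
  simp only [hexp]
  have hadd := integral_add (h22.sub (h12.const_mul 2)) h11
  simp only [Pi.sub_apply] at hadd
  rw [hadd, integral_sub h22 (h12.const_mul 2),
    integral_const_mul, hcross]
  simp only [sq]
  ring

/-- Conditional laws with respect to nested σ-fields that have the same law coincide: the smaller
σ-field already carries all the information on `Z`. -/
lemma IsCondLaw.ae_eq_of_map_eq (h₁ : IsCondLaw Pr m₁ Z ν₁) (h₂ : IsCondLaw Pr m₂ Z ν₂)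
    (hm : m₁ ≤ m₂) (hm₂ : m₂ ≤ mΩ) (hZ : Measurable Z) (hlaw : Pr.map ν₁ = Pr.map ν₂) {D : Set E}
    (hD : MeasurableSet D) :
    (fun ω => (ν₁ ω : Measure E) D) =ᵐ[Pr] fun ω => (ν₂ ω : Measure E) D := by
  have hν₁ : Measurable ν₁ := h₁.measurable.mono (hm.trans hm₂) le_rfl
  have hν₂ : Measurable ν₂ := h₂.measurable.mono hm₂ le_rfl
  have hmeas : Measurable fun ν : ProbabilityMeasure E => (ν : Measure E).real D ^ 2 :=
    (measurable_eval_measure measurable_id hD).ennreal_toReal.pow_const 2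
  have h := h₁.integral_sq_sub h₂ hm hm₂ hZ hD
  rw [← integral_map (φ := ν₂) (f := fun ν : ProbabilityMeasure E => (ν : Measure E).real D ^ 2)
      hν₂.aemeasurable hmeas.aestronglyMeasurable, ← hlaw,
    integral_map hν₁.aemeasurable hmeas.aestronglyMeasurable, sub_self,
    integral_eq_zero_iff_of_nonneg (fun ω => sq_nonneg _)] at h
  · filter_upwards [h] with ω hω
    have := pow_eq_zero_iff two_ne_zero |>.1 hω
    exact ((ENNReal.toReal_eq_toReal_iff' (measure_ne_top _ _) (measure_ne_top _ _)).1
      (sub_eq_zero.1 this)).symm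
  · exact (memLp_measureReal_sub hν₁ hν₂ hD).integrable_sq

end SecondMoment

/-! ### Laws of random probability measures -/

section Determining

variable {E : Type*} [MeasurableSpace E]

/-- The values of a probability measure on a family of measurable sets. -/
def evalOn (I : Finset {A : Set E // MeasurableSet A}) (ν : ProbabilityMeasure E) : I → ℝ :=
  fun i => (ν : Measure E).real i.1.1

lemma measurable_evalOn (I : Finset {A : Set E // MeasurableSet A}) : Measurable (evalOn I) :=
  measurable_pi_lambda _ fun i => (measurable_eval_measure measurable_id i.1.2).ennreal_toReal

/-- The law of a random probability measure is determined by the characteristic functions of its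
values on finitely many sets. -/
lemma ext_of_charFunDual_evalOn {m₁ m₂ : Measure (ProbabilityMeasure E)}
    [IsFiniteMeasure m₁] [IsFiniteMeasure m₂]
    (h : ∀ I : Finset {A : Set E // MeasurableSet A},
      charFunDual (m₁.map (evalOn I)) = charFunDual (m₂.map (evalOn I))) : m₁ = m₂ := by
  let J : ProbabilityMeasure E → ({A : Set E // MeasurableSet A} → ℝ) :=
    fun ν A => (ν : Measure E).real A.1
  have hJ : Measurable J := measurable_pi_lambda _ fun A =>
    (measurable_eval_measure measurable_id A.2).ennreal_toReal
  have hproj : ∀ m : Measure (ProbabilityMeasure E), [IsFiniteMeasure m] →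
      IsProjectiveLimit (m.map J) fun I => m.map (evalOn I) := by
    intro m _ I
    rw [Measure.map_map (Finset.measurable_restrict I) hJ]
    rfl
  have heq : m₁.map J = m₂.map J := by
    refine (hproj m₁).unique ?_
    have : (fun I => m₁.map (evalOn I)) = fun I => m₂.map (evalOn I) := by
      funext I
      exact Measure.ext_of_charFunDual (h I)
    rw [this]
    exact hproj m₂
  have hle : (inferInstance : MeasurableSpace (ProbabilityMeasure E)) ≤
      MeasurableSpace.comap J inferInstance := by
    have hid : Measurable[MeasurableSpace.comap J inferInstance]
        (id : ProbabilityMeasure E → ProbabilityMeasure E) := by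
      refine Measurable.subtype_mk (f := fun ν : ProbabilityMeasure E => (ν : Measure E)) ?_
        (h := fun ν => ν.2)
      refine Measure.measurable_of_measurable_coe _ fun A hA => ?_
      have : (fun ν : ProbabilityMeasure E => (ν : Measure E) A)
          = fun ν => ENNReal.ofReal (J ν ⟨A, hA⟩) := by
        funext ν
        exact (ofReal_measureReal).symm
      rw [this]
      exact ENNReal.measurable_ofReal.comp
        ((measurable_pi_apply (⟨A, hA⟩ : {A : Set E // MeasurableSet A})).comp (comap_measurable J))
    rw [measurable_iff_comap_le, MeasurableSpace.comap_id] at hid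
    exact hid
  refine Measure.ext fun S hS => ?_
  obtain ⟨S', hS', rfl⟩ := hle S hS
  rw [← Measure.map_apply hJ hS', heq, Measure.map_apply hJ hS']

/-- Two random probability measures that are close in `L²` on each of finitely many sets have
close laws. -/
lemma norm_charFunDual_evalOn_sub_le {Ω : Type*} {mΩ : MeasurableSpace Ω} (Q : Measure Ω)
    [IsProbabilityMeasure Q] {a b : Ω → ProbabilityMeasure E} (ha : Measurable a)
    (hb : Measurable b) (I : Finset {A : Set E // MeasurableSet A}) (L : StrongDual ℝ (I → ℝ)) :
    ‖charFunDual ((Q.map b).map (evalOn I)) L - charFunDual ((Q.map a).map (evalOn I)) L‖ ≤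
      ‖L‖ * ∑ i : I, √(∫ ω, ((b ω : Measure E).real i.1.1 - (a ω : Measure E).real i.1.1) ^ 2 ∂Q) := by
  have hmeas : ∀ {c : Ω → ProbabilityMeasure E}, Measurable c →
      Measurable (evalOn I ∘ c) := fun hc => (measurable_evalOn I).comp hc
  have hexp : Continuous fun v : I → ℝ => Complex.exp (L v * Complex.I) := by fun_prop
  have hchar : ∀ {c : Ω → ProbabilityMeasure E}, Measurable c →
      charFunDual ((Q.map c).map (evalOn I)) L
        = ∫ ω, Complex.exp (L (evalOn I (c ω)) * Complex.I) ∂Q := by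
    intro c hc
    rw [charFunDual_apply, Measure.map_map (measurable_evalOn I) hc,
      integral_map (hmeas hc).aemeasurable hexp.aestronglyMeasurable]
    rfl
  have hint : ∀ {c : Ω → ProbabilityMeasure E}, Measurable c →
      Integrable (fun ω => Complex.exp (L (evalOn I (c ω)) * Complex.I)) Q := by
    intro c hc
    refine Integrable.of_bound (hexp.measurable.comp (hmeas hc)).aestronglyMeasurable 1
      (ae_of_all _ fun ω => ?_)
    rw [Complex.norm_exp_ofReal_mul_I]
  have hsq : ∀ i : I, MemLp
      (fun ω => (b ω : Measure E).real i.1.1 - (a ω : Measure E).real i.1.1) 2 Q :=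
    fun i => memLp_measureReal_sub ha hb i.1.2
  have habs : ∀ i : I, Integrable
      (fun ω => |(b ω : Measure E).real i.1.1 - (a ω : Measure E).real i.1.1|) Q :=
    fun i => ((hsq i).integrable one_le_two).abs
  have hJensen : ∀ i : I,
      ∫ ω, |(b ω : Measure E).real i.1.1 - (a ω : Measure E).real i.1.1| ∂Q ≤
        √(∫ ω, ((b ω : Measure E).real i.1.1 - (a ω : Measure E).real i.1.1) ^ 2 ∂Q) := by
    intro i
    refine Real.le_sqrt_of_sq_le ?_
    have h := (even_two.convexOn_pow (𝕜 := ℝ)).map_integral_le (μ := Q)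
      (continuous_pow 2).continuousOn isClosed_univ (ae_of_all _ fun _ => Set.mem_univ _) (habs i)
      (by simpa only [Function.comp_def, sq_abs] using (hsq i).integrable_sq)
    simpa only [sq_abs] using h
  rw [hchar hb, hchar ha, ← integral_sub (hint hb) (hint ha), Finset.mul_sum]
  calc _ ≤ ∫ ω, ∑ i : I, ‖L‖ * |(b ω : Measure E).real i.1.1 - (a ω : Measure E).real i.1.1| ∂Q := by
        refine (norm_integral_le_integral_norm _).trans (integral_mono
          ((hint hb).sub (hint ha)).norm
          (integrable_finsetSum _ fun i _ => (habs i).const_mul _) fun ω => ?_)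
        have h1 : ‖Complex.exp (L (evalOn I (b ω)) * Complex.I)
            - Complex.exp (L (evalOn I (a ω)) * Complex.I)‖
            ≤ ‖L (evalOn I (b ω)) - L (evalOn I (a ω))‖ := by
          have := Real.norm_exp_I_mul_ofReal_sub_one_le
            (x := L (evalOn I (b ω)) - L (evalOn I (a ω)))
          rw [show Complex.exp (L (evalOn I (b ω)) * Complex.I)
              - Complex.exp (L (evalOn I (a ω)) * Complex.I)
              = (Complex.exp (Complex.I * ((L (evalOn I (b ω)) - L (evalOn I (a ω)) : ℝ) : ℂ)) - 1)
                * Complex.exp (L (evalOn I (a ω)) * Complex.I) by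
            rw [sub_mul, one_mul, ← Complex.exp_add]
            congr 2
            push_cast
            ring, norm_mul, Complex.norm_exp_ofReal_mul_I, mul_one]
          exact this
        refine h1.trans ?_
        rw [← map_sub, ← Finset.mul_sum]
        refine (L.le_opNorm _).trans (mul_le_mul_of_nonneg_left ?_ (norm_nonneg _))
        refine (pi_norm_le_iff_of_nonneg (Finset.sum_nonneg fun i _ => abs_nonneg _)).2 fun i => ?_
        exact Finset.single_le_sum
          (f := fun i : I => |(b ω : Measure E).real i.1.1 - (a ω : Measure E).real i.1.1|)
          (fun j _ => abs_nonneg _) (Finset.mem_univ i)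
    _ ≤ _ := by
        rw [integral_finsetSum _ fun i _ => (habs i).const_mul _]
        refine Finset.sum_le_sum fun i _ => ?_
        rw [integral_const_mul]
        exact mul_le_mul_of_nonneg_left (hJensen i) (norm_nonneg _)

end Determining

/-! ### One step of the filter -/

section FilterStep

variable {Ω E F : Type*} [MeasurableSpace E] [MeasurableSpace F]

/-- The law `P(x, dx') Φ(x', dy)` of the next state and observation, as a probability measure. -/
noncomputable def stepProb (P : Kernel E E) (Φ : Kernel E F) [IsMarkovKernel P] [IsMarkovKernel Φ]
    (x : E) : ProbabilityMeasure (E × F) :=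
  ⟨stepKernel P Φ x, inferInstance⟩

/-- The joint law `stepLaw P Φ ν` of observation and state, as a probability measure. -/
noncomputable def stepLawProb (P : Kernel E E) (Φ : Kernel E F) [IsMarkovKernel P] [IsMarkovKernel Φ]
    (ν : ProbabilityMeasure E) : ProbabilityMeasure (F × E) :=
  ⟨stepLaw P Φ ν, inferInstance⟩

/-- The law of the observation under `stepLaw P Φ ν`. -/
noncomputable def obsLawProb (P : Kernel E E) (Φ : Kernel E F) [IsMarkovKernel P] [IsMarkovKernel Φ]
    (ν : ProbabilityMeasure E) : ProbabilityMeasure F :=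
  ⟨(stepLaw P Φ).fst ν, inferInstance⟩

lemma stepLaw_apply {P : Kernel E E} {Φ : Kernel E F} (ν : ProbabilityMeasure E)
    {D : Set (F × E)} (hD : MeasurableSet D) :
    stepLaw P Φ ν D = ∫⁻ x, stepKernel P Φ x (Prod.swap ⁻¹' D) ∂(ν : Measure E) := by
  rw [stepLaw, Kernel.map_apply' _ measurable_swap _ hD,
    Kernel.comp_apply' _ _ _ (measurable_swap hD)]
  rfl

variable {P : Kernel E E} {Φ : Kernel E F} [IsMarkovKernel P] [IsMarkovKernel Φ]

lemma measurable_stepProb : Measurable (stepProb P Φ) :=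
  (Kernel.measurable (stepKernel P Φ)).subtype_mk

lemma measurable_stepLawProb : Measurable (stepLawProb P Φ) :=
  (Kernel.measurable (stepLaw P Φ)).subtype_mk

lemma measurable_obsLawProb : Measurable (obsLawProb P Φ) :=
  (Kernel.measurable (stepLaw P Φ).fst).subtype_mk

variable {m m₁ mΩ : MeasurableSpace Ω} {Pr : Measure Ω}
  {X' X : Ω → E} {Y : Ω → F} {ν : Ω → ProbabilityMeasure E}

lemma IsCondLaw.predict_obs
    (h : IsCondLaw Pr m (fun ω => (Y ω, X ω)) fun ω => stepLawProb P Φ (ν ω))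
    (hν : Measurable[m] ν) : IsCondLaw Pr m Y fun ω => obsLawProb P Φ (ν ω) := by
  refine ⟨measurable_obsLawProb.comp hν, fun B C hB hC => ?_⟩
  have h1 := h.measure_inter B (Prod.fst ⁻¹' C) hB (measurable_fst hC)
  refine h1.trans (lintegral_congr fun ω => ?_)
  exact (Kernel.fst_apply' (stepLaw P Φ) (ν ω) hC).symm

variable [IsProbabilityMeasure Pr]

/-- Prediction: if `ν` is the conditional law of the present state given `m`, then `stepLaw P Φ ν`
is the conditional law of the next observation and state. -/
lemma IsCondLaw.predict (hν : IsCondLaw Pr m X' ν) (hm : m ≤ m₁) (hm₁ : m₁ ≤ mΩ)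
    (hX' : Measurable X')
    (hstep : IsCondLaw Pr m₁ (fun ω => (X ω, Y ω)) fun ω => stepProb P Φ (X' ω)) :
    IsCondLaw Pr m (fun ω => (Y ω, X ω)) fun ω => stepLawProb P Φ (ν ω) := by
  refine ⟨measurable_stepLawProb.comp hν.measurable, fun B D hB hD => ?_⟩
  have hD' : MeasurableSet (Prod.swap ⁻¹' D : Set (E × F)) := measurable_swap hD
  have h1 := hstep.measure_inter B _ (hm B hB) hD'
  have h2 := hν.setLIntegral (hm.trans hm₁) hX'
    (f := fun x => stepKernel P Φ x (Prod.swap ⁻¹' D)) (Kernel.measurable_coe _ hD') hB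
  refine (h1.trans h2).trans (lintegral_congr fun ω => ?_)
  exact (stepLaw_apply (ν ω) hD).symm

variable [StandardBorelSpace E] [Nonempty E] [MeasurableSpace.CountablyGenerated F]

/-- Correction, by Bayes' rule: `Π(ν, Y)` is the conditional law of the next state given `m` and the
next observation `Y`. -/
lemma IsCondLaw.update (hν : IsCondLaw Pr m X' ν) (hm : m ≤ m₁) (hm₁ : m₁ ≤ mΩ)
    (hX' : Measurable X') (hY : Measurable Y)
    (hstep : IsCondLaw Pr m₁ (fun ω => (X ω, Y ω)) fun ω => stepProb P Φ (X' ω)) :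
    IsCondLaw Pr (m ⊔ MeasurableSpace.comap Y inferInstance) X
      fun ω => HMM.update P Φ (ν ω, Y ω) := by
  have hmΩ : m ≤ mΩ := hm.trans hm₁
  have hpred := hν.predict hm hm₁ hX' hstep
  have hobs := hpred.predict_obs hν.measurable
  have hmeas : Measurable[m ⊔ MeasurableSpace.comap Y inferInstance]
      fun ω => HMM.update P Φ (ν ω, Y ω) := by
    refine (measurable_update P Φ).comp (Measurable.prodMk ?_ ?_)
    · exact hν.measurable.mono le_sup_left le_rfl
    · exact (comap_measurable Y).mono le_sup_right le_rfl
  refine ⟨hmeas, fun B D hB hD => ?_⟩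
  have hle : m ⊔ MeasurableSpace.comap Y inferInstance ≤ mΩ := sup_le hmΩ hY.comap_le
  have hmeas' := measurable_eval_measure (hmeas.mono hle le_rfl) hD
  rw [Set.inter_comm, Set.inter_comm, ← Measure.restrict_apply (hle B hB),
    ← withDensity_apply _ (hle B hB)]
  refine measure_eq_of_forall_inter hmΩ hY.comap_le ?_ hB
  rintro A _ hA ⟨C, hC, rfl⟩
  have hAC : MeasurableSet[mΩ] (A ∩ Y ⁻¹' C) := (hmΩ A hA).inter (hY hC)
  rw [Measure.restrict_apply hAC, withDensity_apply _ hAC]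
  have h1 : Pr (A ∩ Y ⁻¹' C ∩ X ⁻¹' D)
      = ∫⁻ ω in A, ∫⁻ y in C, (stepLaw P Φ).condKernel (ν ω, y) D
          ∂(stepLaw P Φ).fst (ν ω) ∂Pr := by
    rw [Set.inter_assoc]
    refine (hpred.measure_inter A (C ×ˢ D) hA (hC.prod hD)).trans (lintegral_congr fun ω => ?_)
    change stepLaw P Φ (ν ω) (C ×ˢ D) = _
    conv_lhs => rw [← Kernel.disintegrate (stepLaw P Φ) (stepLaw P Φ).condKernel]
    exact Kernel.compProd_apply_prod hC hD
  have hg : Measurable[m.prod inferInstance] fun p : Ω × F =>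
      (A.indicator (fun _ => 1) p.1 : ℝ≥0∞) *
        C.indicator (fun y => (HMM.update P Φ (ν p.1, y) : Measure E) D) p.2 := by
    refine Measurable.mul ((Measurable.indicator (@measurable_const _ _ _ m 1) hA).comp
      (@measurable_fst _ _ m _)) ?_
    have hupd : Measurable[m.prod inferInstance] fun p : Ω × F =>
        (HMM.update P Φ (ν p.1, p.2) : Measure E) D :=
      measurable_eval_measure ((measurable_update P Φ).comp
        ((hν.measurable.comp (@measurable_fst _ _ m _)).prodMk (@measurable_snd _ _ m _))) hD
    exact hupd.indicator ((@measurable_snd Ω F m _) hC)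
  have h2 := hobs.lintegral_prod hmΩ hY hg
  rw [h1, ← lintegral_indicator hAC, ← lintegral_indicator (hmΩ A hA)]
  refine Eq.trans (lintegral_congr fun ω => ?_) (h2.symm.trans (lintegral_congr fun ω => ?_))
  · by_cases hω : ω ∈ A
    · simp only [Set.indicator_of_mem hω, one_mul]
      rw [lintegral_indicator hC]
      rfl
    · simp [Set.indicator_of_notMem hω]
  · by_cases hω : ω ∈ A <;> by_cases hω' : Y ω ∈ C <;>
      simp [hω, hω']

/-- The filter is a Markov process with transition kernel `filterKernel P Φ`. -/
lemma IsCondLaw.map_update (hν : IsCondLaw Pr m X' ν) (hm : m ≤ m₁) (hm₁ : m₁ ≤ mΩ)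
    (hX' : Measurable X') (hY : Measurable Y)
    (hstep : IsCondLaw Pr m₁ (fun ω => (X ω, Y ω)) fun ω => stepProb P Φ (X' ω)) :
    Pr.map (fun ω => HMM.update P Φ (ν ω, Y ω)) = (Pr.map ν).bind (filterKernel P Φ) := by
  have hmΩ : m ≤ mΩ := hm.trans hm₁
  have hobs := (hν.predict hm hm₁ hX' hstep).predict_obs hν.measurable
  have hνm : Measurable ν := hν.measurable.mono hmΩ le_rfl
  have hu : Measurable fun ω => HMM.update P Φ (ν ω, Y ω) :=
    (measurable_update P Φ).comp (hνm.prodMk hY)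
  ext S hS
  rw [Measure.map_apply hu hS,
    Measure.bind_apply hS (Kernel.aemeasurable _),
    lintegral_map (Kernel.measurable_coe _ hS) hνm,
    ← lintegral_indicator_one (hu hS)]
  have hS' : MeasurableSet[m.prod inferInstance]
      ((fun p : Ω × F => HMM.update P Φ (ν p.1, p.2)) ⁻¹' S) :=
    ((measurable_update P Φ).comp
      ((hν.measurable.comp (@measurable_fst _ _ m _)).prodMk (@measurable_snd _ _ m _))) hS
  have h := hobs.lintegral_prod hmΩ hY
    (Measurable.indicator (@measurable_const _ _ _ (m.prod inferInstance) 1) hS')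
  refine Eq.trans h (lintegral_congr fun ω => ?_)
  have hpair : Measurable fun y : F => HMM.update P Φ (ν ω, y) :=
    (measurable_update P Φ).comp measurable_prodMk_left
  rw [filterKernel, Kernel.map_apply' _ (measurable_update P Φ) _ hS,
    Kernel.prod_apply, Kernel.id_apply, Measure.dirac_prod,
    Measure.map_apply measurable_prodMk_left (measurable_update P Φ hS)]
  exact lintegral_indicator_one (hpair hS)

end FilterStep

/-! ### Past σ-fields and shifts -/

section PathSpace

variable {Ω E F : Type*}

/-- The hidden state at time `k` on the canonical path space. -/
def coordX (k : ℤ) (w : ℤ → E × F) : E := (w k).1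

/-- The observation at time `k` on the canonical path space. -/
def coordY (k : ℤ) (w : ℤ → E × F) : F := (w k).2

/-- The path of the process, shifted by `j`, as a map to the canonical path space. -/
def path (X : ℤ → Ω → E) (Y : ℤ → Ω → F) (j : ℤ) (ω : Ω) : ℤ → E × F :=
  fun k => (X (k + j) ω, Y (k + j) ω)

lemma coordX_comp_path (X : ℤ → Ω → E) (Y : ℤ → Ω → F) (j k : ℤ) :
    coordX k ∘ path X Y j = X (k + j) := rfl

lemma coordY_comp_path (X : ℤ → Ω → E) (Y : ℤ → Ω → F) (j k : ℤ) :
    coordY k ∘ path X Y j = Y (k + j) := rfl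

end PathSpace

section Past

variable {Ω E F G : Type*} [MeasurableSpace E] [MeasurableSpace F] [MeasurableSpace G]

lemma comap_le_past (Z : ℤ → Ω → G) {k n : ℤ} (hk : k ≤ n) :
    MeasurableSpace.comap (Z k) inferInstance ≤ past Z n :=
  le_iSup₂_of_le k hk le_rfl

lemma measurable_past (Z : ℤ → Ω → G) {k n : ℤ} (hk : k ≤ n) : Measurable[past Z n] (Z k) :=
  measurable_iff_comap_le.2 (comap_le_past Z hk)

lemma past_mono (Z : ℤ → Ω → G) : Monotone (past Z) :=
  fun _ _ hij => iSup₂_le fun _ hk => comap_le_past Z (hk.trans hij)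

lemma past_le {mΩ : MeasurableSpace Ω} {Z : ℤ → Ω → G} (hZ : ∀ k, Measurable (Z k)) (n : ℤ) :
    past Z n ≤ mΩ :=
  iSup₂_le fun k _ => (hZ k).comap_le

lemma past_succ (Z : ℤ → Ω → G) (n : ℤ) :
    past Z (n + 1) = past Z n ⊔ MeasurableSpace.comap (Z (n + 1)) inferInstance := by
  apply le_antisymm
  · refine iSup₂_le fun k hk => ?_
    rcases hk.lt_or_eq with h | rfl
    · exact (comap_le_past Z (Int.lt_add_one_iff.1 h)).trans le_sup_left
    · exact le_sup_right
  · exact sup_le (past_mono Z (Int.le_add_one le_rfl)) (comap_le_past Z le_rfl)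

lemma past_prodMk (X : ℤ → Ω → E) (Y : ℤ → Ω → F) (n : ℤ) :
    past (fun k ω => (X k ω, Y k ω)) n = past Y n ⊔ past X n := by
  simp only [past]
  rw [sup_comm, ← iSup_sup_eq]
  refine iSup_congr fun k => ?_
  rw [← iSup_sup_eq]
  exact iSup_congr fun _ => MeasurableSpace.comap_prodMk _ _

lemma comap_past_shift {Ω' : Type*} {Z : ℤ → Ω → G} {Z' : ℤ → Ω' → G} {T : Ω → Ω'} {j : ℤ}
    (hT : ∀ k, Z' k ∘ T = Z (k + j)) (n : ℤ) : (past Z' n).comap T = past Z (n + j) := by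
  simp only [past, MeasurableSpace.comap_iSup, MeasurableSpace.comap_comp, hT]
  apply le_antisymm
  · exact iSup₂_le fun k hk => le_iSup₂_of_le (k + j) (by omega) le_rfl
  · refine iSup₂_le fun k hk => le_iSup₂_of_le (k - j) (by omega) ?_
    rw [sub_add_cancel]

/-- The σ-field `⋂_k (𝓕^Y_{-∞,j} ∨ 𝓕^X_{-∞,j-k})`: the observations up to time `j` together with
the remote past of the hidden states. -/
@[reducible] def tailField (X : ℤ → Ω → E) (Y : ℤ → Ω → F) (j : ℤ) : MeasurableSpace Ω :=
  ⨅ k : ℕ, past Y j ⊔ past X (j - k)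

lemma antitone_past_sup_past (X : ℤ → Ω → E) (Y : ℤ → Ω → F) (j : ℤ) :
    Antitone fun k : ℕ => past Y j ⊔ past X (j - k) :=
  fun _ _ hkl => sup_le_sup le_rfl (past_mono X (by omega))

lemma past_le_tailField (X : ℤ → Ω → E) (Y : ℤ → Ω → F) (j : ℤ) : past Y j ≤ tailField X Y j :=
  le_iInf fun _ => le_sup_left

lemma tailField_le (X : ℤ → Ω → E) (Y : ℤ → Ω → F) (j : ℤ) :
    tailField X Y j ≤ past Y j ⊔ past X j :=
  (iInf_le _ 0).trans (by simp)

lemma tailField_zero (X : ℤ → Ω → E) (Y : ℤ → Ω → F) :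
    ⨅ (n : ℤ) (_ : n ≤ 0), past Y 0 ⊔ past X n = tailField X Y 0 := by
  apply le_antisymm
  · exact le_iInf fun k => iInf₂_le_of_le (0 - k) (by omega) le_rfl
  · refine le_iInf₂ fun n hn => iInf_le_of_le n.natAbs ?_
    exact sup_le_sup le_rfl (past_mono X (by omega))

lemma comap_tailField_shift {Ω' : Type*} {X : ℤ → Ω → E} {Y : ℤ → Ω → F} {X' : ℤ → Ω' → E}
    {Y' : ℤ → Ω' → F} {T : Ω → Ω'} {j : ℤ} (hX : ∀ k, X' k ∘ T = X (k + j))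
    (hY : ∀ k, Y' k ∘ T = Y (k + j)) (n : ℤ) :
    (tailField X' Y' n).comap T = tailField X Y (n + j) := by
  rw [tailField, comap_iInf_of_antitone (antitone_past_sup_past X' Y' n)]
  refine iInf_congr fun k => ?_
  rw [MeasurableSpace.comap_sup, comap_past_shift hX, comap_past_shift hY]
  congr 2
  omega

lemma measurable_coordX (k : ℤ) : Measurable (coordX k : (ℤ → E × F) → E) :=
  measurable_fst.comp (measurable_pi_apply k)

lemma measurable_coordY (k : ℤ) : Measurable (coordY k : (ℤ → E × F) → F) :=
  measurable_snd.comp (measurable_pi_apply k)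

/-- The law of the process on the canonical path space. -/
noncomputable def pathLaw [MeasurableSpace Ω] (Pr : Measure Ω) (X : ℤ → Ω → E) (Y : ℤ → Ω → F) :
    Measure (ℤ → E × F) :=
  Pr.map fun ω k => (X k ω, Y k ω)

end Past

/-! ### Stationary hidden Markov models -/

section Stationary

variable {Ω E F : Type*} [MeasurableSpace E] [MeasurableSpace F] {mΩ : MeasurableSpace Ω}
  {Pr : Measure Ω} {P : Kernel E E} {Φ : Kernel E F}
  {X : ℤ → Ω → E} {Y : ℤ → Ω → F}

lemma IsStationaryHMM.measurePreserving_path (h : IsStationaryHMM Pr P Φ X Y) (j : ℤ) :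
    MeasurePreserving (path X Y j) Pr (pathLaw Pr X Y) :=
  ⟨measurable_pi_lambda _ fun k => (h.measurable_X (k + j)).prodMk (h.measurable_Y (k + j)),
    h.stationary j⟩

lemma IsStationaryHMM.map_X (h : IsStationaryHMM Pr P Φ X Y) (j : ℤ) :
    Pr.map (X j) = Pr.map (X 0) := by
  have hj : X j = coordX 0 ∘ path X Y j := by rw [coordX_comp_path, zero_add]
  rw [hj, ← Measure.map_map (measurable_coordX 0) (h.measurePreserving_path j).measurable,
    (h.measurePreserving_path j).map_eq, ← (h.measurePreserving_path 0).map_eq,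
    Measure.map_map (measurable_coordX 0) (h.measurePreserving_path 0).measurable]
  rfl

lemma IsStationaryHMM.past_le (h : IsStationaryHMM Pr P Φ X Y) (i j : ℤ) :
    past Y i ⊔ past X j ≤ mΩ :=
  sup_le (HMM.past_le h.measurable_Y i) (HMM.past_le h.measurable_X j)

variable [IsProbabilityMeasure Pr]

lemma IsStationaryHMM.isProbabilityMeasure_pathLaw (h : IsStationaryHMM Pr P Φ X Y) :
    IsProbabilityMeasure (pathLaw Pr X Y) := by
  rw [← (h.measurePreserving_path 0).map_eq]
  exact Measure.isProbabilityMeasure_map (h.measurePreserving_path 0).measurable.aemeasurable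

variable [IsMarkovKernel P] [IsMarkovKernel Φ]

/-- The Markov property: given the past of states and observations up to time `j`, the next pair has
law `P(X_j, dx) Φ(x, dy)`. -/
lemma IsStationaryHMM.isCondLaw_step (h : IsStationaryHMM Pr P Φ X Y) (j : ℤ) :
    IsCondLaw Pr (past Y j ⊔ past X j) (fun ω => (X (j + 1) ω, Y (j + 1) ω))
      fun ω => stepProb P Φ (X j ω) := by
  have hle := h.past_le j j
  have hmeas : Measurable[past Y j ⊔ past X j] fun ω => stepProb P Φ (X j ω) :=
    measurable_stepProb.comp ((measurable_past X le_rfl).mono le_sup_right le_rfl)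
  refine ⟨hmeas, fun B D hB hD => ?_⟩
  have hcond := (h.markov (j + 1) D hD).trans (h.transition (j + 1) D hD)
  rw [past_prodMk, add_sub_cancel_right] at hcond
  have hZ : Measurable fun ω => (X (j + 1) ω, Y (j + 1) ω) :=
    (h.measurable_X _).prodMk (h.measurable_Y _)
  have hint := setIntegral_condExp hle ((integrable_const (μ := Pr) (1 : ℝ)).indicator (hZ hD)) hB
  rw [setIntegral_congr_ae (hle B hB) (hcond.mono fun ω hω _ => hω),
    integral_indicator (hZ hD), setIntegral_const, smul_eq_mul, mul_one,
    measureReal_restrict_apply (hZ hD), Set.inter_comm] at hint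
  have hne : ∫⁻ ω in B, (stepProb P Φ (X j ω) : Measure (E × F)) D ∂Pr ≠ ∞ := by
    refine ((setLIntegral_mono' (g := fun _ => 1) (hle B hB) fun ω _ => prob_le_one).trans_lt ?_).ne
    simp
  rw [← ENNReal.toReal_eq_toReal_iff' (measure_ne_top _ _) hne]
  refine hint.symm.trans ?_
  refine integral_toReal ?_ (ae_of_all _ fun ω => measure_lt_top _ _)
  exact (measurable_eval_measure (hmeas.mono hle le_rfl) hD).aemeasurable

end Stationary

/-! ### Invariant laws of the filter -/

section Invariant

variable {Ω E : Type*} [MeasurableSpace E] {m m' mΩ : MeasurableSpace Ω} {Pr : Measure Ω}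
  {Z : Ω → E} {ν ν' : Ω → ProbabilityMeasure E}

/-- A conditional law given `m` is one given any larger σ-field that adds only null sets. -/
lemma IsCondLaw.of_ae_eq (h : IsCondLaw Pr m Z ν) (hm : m ≤ m')
    (hae : ∀ B, MeasurableSet[m'] B → ∃ B', MeasurableSet[m] B' ∧ B =ᵐ[Pr] B') :
    IsCondLaw Pr m' Z ν := by
  refine ⟨h.measurable.mono hm le_rfl, fun B D hB hD => ?_⟩
  obtain ⟨B', hB', hBB'⟩ := hae B hB
  have hBD : (B ∩ Z ⁻¹' D : Set Ω) =ᵐ[Pr] (B' ∩ Z ⁻¹' D : Set Ω) := hBB'.inter (ae_eq_refl _)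
  rw [measure_congr hBD, Measure.restrict_congr_set hBB']
  exact h.measure_inter B' D hB' hD

lemma IsCondLaw.hasBarycenter (h : IsCondLaw Pr m Z ν) (hm : m ≤ mΩ) (hZ : Measurable Z) :
    HasBarycenter (Pr.map ν) (Pr.map Z) := by
  intro A hA
  have hν : Measurable ν := h.measurable.mono hm le_rfl
  rw [lintegral_map (f := fun ν : ProbabilityMeasure E => (ν : Measure E) A)
    (measurable_eval_measure measurable_id hA) hν, Measure.map_apply hZ hA]
  have h1 := h.measure_inter Set.univ A MeasurableSet.univ hA
  rwa [Set.univ_inter, Measure.restrict_univ] at h1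

variable [IsProbabilityMeasure Pr]

/-- All versions of a conditional law have the same law. -/
lemma IsCondLaw.map_eq (h : IsCondLaw Pr m Z ν) (h' : IsCondLaw Pr m Z ν') (hm : m ≤ mΩ)
    (hZ : Measurable Z) : Pr.map ν = Pr.map ν' := by
  have hν := h.measurable.mono hm le_rfl
  have hν' := h'.measurable.mono hm le_rfl
  have := Measure.isProbabilityMeasure_map (μ := Pr) hν.aemeasurable
  have := Measure.isProbabilityMeasure_map (μ := Pr) hν'.aemeasurable
  refine ext_of_charFunDual_evalOn fun I => ?_
  ext L
  rw [← sub_eq_zero, ← norm_le_zero_iff]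
  refine (norm_charFunDual_evalOn_sub_le Pr hν' hν I L).trans_eq ?_
  rw [Finset.sum_eq_zero, mul_zero]
  intro i _
  have hae := (h.ae_eq_condExp hm hZ i.1.2).trans (h'.ae_eq_condExp hm hZ i.1.2).symm
  rw [integral_eq_zero_of_ae, Real.sqrt_zero]
  filter_upwards [hae] with ω hω
  simp [hω]

end Invariant

section InvariantFilter

variable {Ω E F : Type*} [MeasurableSpace E] [MeasurableSpace F] {mΩ : MeasurableSpace Ω}
  {Pr : Measure Ω} {P : Kernel E E} {Φ : Kernel E F} [IsMarkovKernel P] [IsMarkovKernel Φ]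
  [IsProbabilityMeasure Pr] {X : ℤ → Ω → E} {Y : ℤ → Ω → F}

variable [StandardBorelSpace E] [Nonempty E] [MeasurableSpace.CountablyGenerated F]

/-- Let `T₀`, `T₁` map to a space `Ω'` that carries a state variable and a σ-field `m`, so that the
state at time `j` and a σ-field of the past of time `j` are their inverse images under `T_j`.
If observing `Y_1` in addition to the σ-field at time `0` amounts, up to null sets, to the σ-field
at time `1`, then the law of the conditional law of the state given `m` is invariant under the
filter. -/
lemma IsStationaryHMM.invariant (h : IsStationaryHMM Pr P Φ X Y) {Ω' : Type*}
    {m mΩ' : MeasurableSpace Ω'} {Pr' : Measure Ω'} {T₀ T₁ : Ω → Ω'} {X' : Ω' → E}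
    (hT₀ : MeasurePreserving T₀ Pr Pr') (hT₁ : MeasurePreserving T₁ Pr Pr')
    (hX' : Measurable X') (hX₀ : X' ∘ T₀ = X 0) (hX₁ : X' ∘ T₁ = X 1) (hm : m ≤ mΩ')
    (hm₀ : m.comap T₀ ≤ past Y 0 ⊔ past X 0)
    (hle : m.comap T₀ ⊔ MeasurableSpace.comap (Y 1) inferInstance ≤ m.comap T₁)
    (hae : ∀ B, MeasurableSet[m.comap T₁] B →
      ∃ B', MeasurableSet[m.comap T₀ ⊔ MeasurableSpace.comap (Y 1) inferInstance] B' ∧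
        B =ᵐ[Pr] B')
    {ν : Ω' → ProbabilityMeasure E} (hν : IsCondLaw Pr' m X' ν) :
    Kernel.Invariant (filterKernel P Φ) (Pr'.map ν) := by
  have hνm : Measurable ν := hν.measurable.mono hm le_rfl
  have hcond₀ := hν.comap hm hT₀ hX'
  have hcond₁ := hν.comap hm hT₁ hX'
  rw [hX₀] at hcond₀
  rw [hX₁] at hcond₁
  have hlaw₀ : Pr.map (ν ∘ T₀) = Pr'.map ν := by
    rw [← Measure.map_map hνm hT₀.measurable, hT₀.map_eq]
  have hlaw₁ : Pr.map (ν ∘ T₁) = Pr'.map ν := by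
    rw [← Measure.map_map hνm hT₁.measurable, hT₁.map_eq]
  have hstep := h.isCondLaw_step 0
  rw [zero_add] at hstep
  have hup := (hcond₀.update hm₀ (h.past_le 0 0) (h.measurable_X _) (h.measurable_Y 1)
    hstep).of_ae_eq hle hae
  have heq := hup.map_eq hcond₁ ((MeasurableSpace.comap_mono hm).trans hT₁.measurable.comap_le)
    (h.measurable_X 1)
  have hmap := hcond₀.map_update hm₀ (h.past_le 0 0) (h.measurable_X _) (h.measurable_Y 1) hstep
  rw [heq, hlaw₀, hlaw₁] at hmap
  exact hmap.symm

/-- The law of the conditional law of the state given the observations is invariant. -/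
lemma IsStationaryHMM.invariant_past (h : IsStationaryHMM Pr P Φ X Y)
    {ν : (ℤ → E × F) → ProbabilityMeasure E}
    (hν : IsCondLaw (pathLaw Pr X Y) (past coordY 0) (coordX 0) ν) :
    Kernel.Invariant (filterKernel P Φ) ((pathLaw Pr X Y).map ν) := by
  have h₀ : (past coordY 0).comap (path X Y 0) = past Y 0 :=
    comap_past_shift (coordY_comp_path X Y 0) 0
  have h₁ : (past coordY 0).comap (path X Y 1) =
      past Y 0 ⊔ MeasurableSpace.comap (Y 1) inferInstance :=
    (comap_past_shift (coordY_comp_path X Y 1) 0).trans (past_succ Y 0)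
  refine h.invariant (h.measurePreserving_path 0) (h.measurePreserving_path 1)
    (measurable_coordX 0) rfl rfl (HMM.past_le measurable_coordY 0) ?_ ?_ ?_ hν
  · rw [h₀]
    exact le_sup_left
  · rw [h₀, h₁]
  · rw [h₀, h₁]
    exact fun B hB => ⟨B, hB, ae_eq_refl _⟩

end InvariantFilter

/-! ### Coupling an invariant law with the hidden Markov model -/

section Coupling

variable {W E : Type*} [MeasurableSpace E]

lemma IsCondLaw.of_comap {Ω : Type*} {mΩ : MeasurableSpace Ω} {m mW : MeasurableSpace W}
    {Pr : Measure Ω} {Pr' : Measure W} (hm : m ≤ mW) {Z : W → E} {ν : W → ProbabilityMeasure E}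
    {T : Ω → W} (hT : MeasurePreserving T Pr Pr') (hZ : Measurable Z) (hν : Measurable[m] ν)
    (h : IsCondLaw Pr (m.comap T) (Z ∘ T) (ν ∘ T)) : IsCondLaw Pr' m Z ν := by
  refine ⟨hν, fun B D hB hD => ?_⟩
  rw [← hT.measure_preimage ((hm B hB).inter (hZ hD)).nullMeasurableSet,
    ← hT.setLIntegral_comp_preimage (hm B hB)
      (measurable_eval_measure (hν.mono hm le_rfl) hD)]
  exact h.measure_inter _ D ⟨B, hB, rfl⟩ hD

/-- The joint law of a random probability measure `ν` with law `m` and a path `w` whose state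
`x w` is drawn from `ν` and whose other coordinates are drawn, given `x w`, from the conditional
law under `Pr`. -/
noncomputable def coupling {mW : MeasurableSpace W} [StandardBorelSpace W] [Nonempty W]
    (m : Measure (ProbabilityMeasure E)) (Pr : Measure W) [IsFiniteMeasure Pr] (x : W → E) :
    Measure (ProbabilityMeasure E × W) :=
  m ⊗ₘ (condDistrib id x Pr ∘ₖ evalKernel E)

variable {H mW : MeasurableSpace W} [StandardBorelSpace W] [Nonempty W]
  {m : Measure (ProbabilityMeasure E)} {Pr : Measure W}
  [IsProbabilityMeasure Pr] {x : W → E}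

lemma evalKernel_bind_eq {μ : Measure E} (hbary : HasBarycenter m μ) :
    m.bind (evalKernel E) = μ := by
  ext A hA
  rw [Measure.bind_apply hA (Kernel.aemeasurable _), hbary A hA]
  rfl

variable [IsProbabilityMeasure m]

instance : IsProbabilityMeasure (coupling m Pr x) := by
  unfold coupling
  infer_instance

lemma measurePreserving_fst_coupling :
    MeasurePreserving Prod.fst (coupling m Pr x) m :=
  ⟨measurable_fst, Measure.fst_compProd _ _⟩

lemma measurePreserving_snd_coupling (hx : Measurable x) (hbary : HasBarycenter m (Pr.map x)) :
    MeasurePreserving Prod.snd (coupling m Pr x) Pr := by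
  refine ⟨measurable_snd, ?_⟩
  change (coupling m Pr x).snd = Pr
  rw [coupling, Measure.snd_compProd, ← Measure.comp_assoc, evalKernel_bind_eq hbary,
    condDistrib_comp_map hx.aemeasurable measurable_id.aemeasurable, Measure.map_id]

/-- On the event `ν ∈ N` the path has, with respect to its original law, a density that depends only
on the state `x`: the random measure `ν` influences the path only through that state. -/
lemma exists_coupling_density (hx : Measurable x) (hbary : HasBarycenter m (Pr.map x))
    {N : Set (ProbabilityMeasure E)} (hN : MeasurableSet N) :
    ∃ r : E → ℝ≥0∞, Measurable r ∧
      (∀ A : Set E, MeasurableSet A →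
        ∫⁻ ν in N, (ν : Measure E) A ∂m = ∫⁻ w, r (x w) * A.indicator (fun _ => 1) (x w) ∂Pr) ∧
      ∀ f : W → ℝ≥0∞, Measurable f →
        ∫⁻ p in Prod.fst ⁻¹' N, f p.2 ∂coupling m Pr x = ∫⁻ w, r (x w) * f w ∂Pr := by
  set μ : Measure E := Pr.map x with hμ
  have : IsProbabilityMeasure μ := Measure.isProbabilityMeasure_map hx.aemeasurable
  set ρ : Measure E := (m.restrict N).bind (evalKernel E) with hρ
  have hρA : ∀ A, MeasurableSet A → ρ A = ∫⁻ ν in N, (ν : Measure E) A ∂m := fun A hA =>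
    Measure.bind_apply hA (Kernel.aemeasurable _)
  have hle : ρ ≤ μ := by
    refine Measure.le_iff.2 fun A hA => ?_
    rw [hρA A hA, hbary A hA]
    exact setLIntegral_le_lintegral _ _
  have : IsFiniteMeasure ρ := ⟨(hle _).trans_lt (measure_lt_top μ _)⟩
  have hwd : μ.withDensity (ρ.rnDeriv μ) = ρ :=
    Measure.withDensity_rnDeriv_eq _ _ (Measure.absolutelyContinuous_of_le hle)
  have hr := Measure.measurable_rnDeriv ρ μ
  have hint : ∀ g : E → ℝ≥0∞, Measurable g → ∫⁻ y, g y ∂ρ = ∫⁻ y, ρ.rnDeriv μ y * g y ∂μ := by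
    intro g hg
    conv_lhs => rw [← hwd]
    exact lintegral_withDensity_eq_lintegral_mul μ hr hg
  refine ⟨ρ.rnDeriv μ, hr, fun A hA => ?_, fun f hf => ?_⟩
  · have hind : Measurable (A.indicator fun _ => (1 : ℝ≥0∞)) := measurable_const.indicator hA
    rw [← hρA A hA, ← lintegral_indicator_one hA]
    exact (hint _ hind).trans (lintegral_map (hr.mul hind) hx)
  · have hκf : Measurable fun y => ∫⁻ w, f w ∂condDistrib id x Pr y := hf.lintegral_kernel
    have h1 : ∫⁻ p in Prod.fst ⁻¹' N, f p.2 ∂coupling m Pr x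
        = ∫⁻ y, ∫⁻ w, f w ∂condDistrib id x Pr y ∂ρ := by
      rw [hρ, Measure.lintegral_bind (Kernel.aemeasurable _) hκf.aemeasurable, coupling,
        ← Set.prod_univ]
      refine (Measure.setLIntegral_compProd (f := fun p => f p.2) (hf.comp measurable_snd) hN
        MeasurableSet.univ).trans (lintegral_congr fun ν => ?_)
      rw [Measure.restrict_univ, Kernel.lintegral_comp _ _ _ hf]
    have h2 : Measurable fun p : E × W => ρ.rnDeriv μ p.1 * f p.2 :=
      (hr.comp measurable_fst).mul (hf.comp measurable_snd)
    have h3 := Measure.lintegral_compProd (μ := μ) (κ := condDistrib id x Pr) h2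
    rw [hμ, compProd_map_condDistrib measurable_id.aemeasurable,
      lintegral_map h2 (hx.prodMk measurable_id)] at h3
    rw [h1, hint _ hκf]
    refine Eq.trans (lintegral_congr fun y => ?_) h3.symm
    exact (lintegral_const_mul _ hf).symm

lemma isCondLaw_fst_coupling (hx : Measurable x) (hbary : HasBarycenter m (Pr.map x)) :
    IsCondLaw (coupling m Pr x) (MeasurableSpace.comap Prod.fst inferInstance)
      (fun p => x p.2) Prod.fst := by
  refine ⟨comap_measurable _, ?_⟩
  rintro _ D ⟨N, hN, rfl⟩ hD
  obtain ⟨r, -, hr₁, hr₂⟩ := exists_coupling_density hx hbary hN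
  have hxD : MeasurableSet ((fun p : ProbabilityMeasure E × W => x p.2) ⁻¹' D) :=
    (hx.comp measurable_snd) hD
  rw [Set.inter_comm, ← Measure.restrict_apply hxD, ← lintegral_indicator_one hxD]
  refine (hr₂ ((x ⁻¹' D).indicator fun _ => 1) (measurable_const.indicator (hx hD))).trans ?_
  exact (hr₁ D hD).symm.trans (measurePreserving_fst_coupling.setLIntegral_comp_preimage hN
    (measurable_eval_measure measurable_id hD)).symm

/-- Conditional laws of functions of the path, given a σ-field of the path space with respect to
which `x` is measurable, are not changed by knowing `ν` in addition. -/
lemma IsCondLaw.coupling {G : Type*} [MeasurableSpace G] {Z : W → G} {η : W → ProbabilityMeasure G}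
    (h : IsCondLaw Pr H Z η) (hH : H ≤ mW) (hZ : Measurable Z) (hxH : Measurable[H] x)
    (hbary : HasBarycenter m (Pr.map x)) :
    IsCondLaw (HMM.coupling m Pr x) (MeasurableSpace.comap Prod.fst inferInstance ⊔ H.comap Prod.snd)
      (fun p => Z p.2) fun p => η p.2 := by
  have hx : Measurable x := hxH.mono hH le_rfl
  have hfst : MeasurableSpace.comap Prod.fst inferInstance ≤
      (inferInstance : MeasurableSpace (ProbabilityMeasure E × W)) := measurable_fst.comap_le
  have hsnd : H.comap Prod.snd ≤ (inferInstance : MeasurableSpace (ProbabilityMeasure E × W)) :=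
    (MeasurableSpace.comap_mono hH).trans measurable_snd.comap_le
  refine ⟨h.measurable.comp ((comap_measurable _).mono le_sup_right le_rfl), fun B D hB hD => ?_⟩
  have hB' := sup_le hfst hsnd B hB
  have hη : Measurable fun w => (η w : Measure G) D :=
    measurable_eval_measure (h.measurable.mono hH le_rfl) hD
  rw [Set.inter_comm, Set.inter_comm, ← Measure.restrict_apply hB', ← withDensity_apply _ hB']
  refine measure_eq_of_forall_inter hfst hsnd ?_ hB
  rintro _ _ ⟨N, hN, rfl⟩ ⟨A, hA, rfl⟩
  obtain ⟨r, hr, -, hr₂⟩ := exists_coupling_density hx hbary hN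
  have hNm : MeasurableSet (Prod.fst ⁻¹' N : Set (ProbabilityMeasure E × W)) := measurable_fst hN
  have hAm : MeasurableSet (Prod.snd ⁻¹' A : Set (ProbabilityMeasure E × W)) :=
    measurable_snd (hH A hA)
  have hZD : MeasurableSet (A ∩ Z ⁻¹' D) := (hH A hA).inter (hZ hD)
  rw [Measure.restrict_apply (hNm.inter hAm), withDensity_apply _ (hNm.inter hAm)]
  have h1 : HMM.coupling m Pr x (Prod.fst ⁻¹' N ∩ Prod.snd ⁻¹' A ∩ (fun p => Z p.2) ⁻¹' D)
      = ∫⁻ w, r (x w) * (A ∩ Z ⁻¹' D).indicator (fun _ => 1) w ∂Pr := by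
    rw [← hr₂ _ (measurable_const.indicator hZD), Set.inter_assoc, Set.inter_comm,
      ← Measure.restrict_apply' hNm]
    exact (lintegral_indicator_one (measurable_snd hZD)).symm
  have h2 : ∫⁻ p in Prod.fst ⁻¹' N ∩ Prod.snd ⁻¹' A, (η p.2 : Measure G) D ∂HMM.coupling m Pr x
      = ∫⁻ w, r (x w) * A.indicator (fun w => (η w : Measure G) D) w ∂Pr := by
    rw [← hr₂ _ (hη.indicator (hH A hA)), Set.inter_comm, ← Measure.restrict_restrict hAm,
      ← lintegral_indicator hAm]
    rfl
  have hg : Measurable[H] fun w => r (x w) * A.indicator (fun _ => 1) w :=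
    (hr.comp hxH).mul (Measurable.indicator (@measurable_const _ _ _ H 1) hA)
  have h3 := h.lintegral_mul hH hZ hg hD
  rw [← lintegral_indicator (hZ hD)] at h3
  rw [h1, h2]
  refine Eq.trans (lintegral_congr fun w => ?_) (h3.trans (lintegral_congr fun w => ?_))
  · by_cases hw : w ∈ A <;> by_cases hw' : Z w ∈ D <;> simp [hw, hw']
  · by_cases hw : w ∈ A <;> simp [hw]

end Coupling

/-! ### Uniqueness of the invariant law -/

section Window

variable {W G : Type*} [MeasurableSpace G]

/-- The σ-field `σ{Z_k : a < k ≤ b}`. -/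
@[reducible] def window (Z : ℤ → W → G) (a b : ℤ) : MeasurableSpace W :=
  ⨆ (k : ℤ) (_ : a < k ∧ k ≤ b), MeasurableSpace.comap (Z k) inferInstance

lemma window_self (Z : ℤ → W → G) (a : ℤ) : window Z a a = ⊥ :=
  le_bot_iff.1 (iSup₂_le fun _ hk => absurd hk.1 hk.2.not_gt)

lemma window_succ (Z : ℤ → W → G) {a b : ℤ} (hab : a ≤ b) :
    window Z a (b + 1) = window Z a b ⊔ MeasurableSpace.comap (Z (b + 1)) inferInstance := by
  apply le_antisymm
  · refine iSup₂_le fun k hk => ?_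
    rcases hk.2.lt_or_eq with h | rfl
    · exact le_sup_of_le_left (le_iSup₂_of_le k ⟨hk.1, Int.lt_add_one_iff.1 h⟩ le_rfl)
    · exact le_sup_right
  · exact sup_le (iSup₂_le fun k hk => le_iSup₂_of_le k ⟨hk.1, by omega⟩ le_rfl)
      (le_iSup₂_of_le (b + 1) ⟨by omega, le_rfl⟩ le_rfl)

lemma window_le_past (Z : ℤ → W → G) (a b : ℤ) : window Z a b ≤ past Z b :=
  iSup₂_le fun _ hk => comap_le_past Z hk.2

lemma window_anti (Z : ℤ → W → G) (b : ℤ) {a a' : ℤ} (h : a ≤ a') : window Z a' b ≤ window Z a b :=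
  iSup₂_le fun k hk => le_iSup₂_of_le k ⟨h.trans_lt hk.1, hk.2⟩ le_rfl

lemma iSup_window (Z : ℤ → W → G) (b : ℤ) : ⨆ n : ℕ, window Z (b - n) b = past Z b := by
  apply le_antisymm
  · exact iSup_le fun n => window_le_past Z _ b
  · refine iSup₂_le fun k hk => le_iSup_of_le ((b - k).toNat + 1) ?_
    exact le_iSup₂_of_le k ⟨by omega, hk⟩ le_rfl

end Window

section CoupledFilter

variable {W E F : Type*} [MeasurableSpace E] [MeasurableSpace F] {mW : MeasurableSpace W}
  [StandardBorelSpace W] [Nonempty W] {Pr : Measure W} [IsProbabilityMeasure Pr]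
  {P : Kernel E E} {Φ : Kernel E F} [IsMarkovKernel P] [IsMarkovKernel Φ]
  [StandardBorelSpace E] [Nonempty E] [MeasurableSpace.CountablyGenerated F]
  {X : ℤ → W → E} {Y : ℤ → W → F} {m : Measure (ProbabilityMeasure E)} [IsProbabilityMeasure m]

/-- The filter started at time `a` from a random measure `ν` with the invariant law `m` still has
law `m` at time `b`, where it is the conditional law of the state given `ν` and the observations
made in the meantime. -/
lemma exists_isCondLaw_coupling (hX : ∀ k, Measurable (X k)) (hY : ∀ k, Measurable (Y k))
    (hstep : ∀ j, IsCondLaw Pr (past Y j ⊔ past X j) (fun w => (X (j + 1) w, Y (j + 1) w))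
      fun w => stepProb P Φ (X j w))
    (hinv : Kernel.Invariant (filterKernel P Φ) m) {a b : ℤ} (hab : a ≤ b)
    (hbary : HasBarycenter m (Pr.map (X a))) :
    ∃ ν, IsCondLaw (coupling m Pr (X a))
        (MeasurableSpace.comap Prod.fst inferInstance ⊔ (window Y a b).comap Prod.snd)
        (fun p => X b p.2) ν ∧
      (coupling m Pr (X a)).map ν = m := by
  induction b, hab using Int.leInduction with
  | base =>
    refine ⟨Prod.fst, ?_, measurePreserving_fst_coupling.map_eq⟩
    rw [window_self, MeasurableSpace.comap_bot, sup_bot_eq]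
    exact isCondLaw_fst_coupling (hX a) hbary
  | succ b hab ih =>
    obtain ⟨ν, hν, hνm⟩ := ih
    have hpast : past Y b ⊔ past X b ≤ mW := sup_le (past_le hY b) (past_le hX b)
    have hstep' := (hstep b).coupling hpast ((hX _).prodMk (hY _))
      ((measurable_past X hab).mono le_sup_right le_rfl) hbary
    have hle : MeasurableSpace.comap Prod.fst inferInstance ⊔ (window Y a b).comap Prod.snd ≤
        MeasurableSpace.comap (Prod.fst : ProbabilityMeasure E × W → _) inferInstance ⊔
          (past Y b ⊔ past X b).comap Prod.snd :=
      sup_le_sup le_rfl (MeasurableSpace.comap_mono ((window_le_past Y a b).trans le_sup_left))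
    have hle' : MeasurableSpace.comap Prod.fst inferInstance ⊔ (past Y b ⊔ past X b).comap Prod.snd ≤
        (inferInstance : MeasurableSpace (ProbabilityMeasure E × W)) :=
      sup_le measurable_fst.comap_le
        ((MeasurableSpace.comap_mono hpast).trans measurable_snd.comap_le)
    refine ⟨_, ?_, (hν.map_update hle hle' ((hX b).comp measurable_snd)
      ((hY (b + 1)).comp measurable_snd) hstep').trans ?_⟩
    · have h := hν.update hle hle' ((hX b).comp measurable_snd)
        ((hY (b + 1)).comp measurable_snd) hstep'
      rw [window_succ Y hab, MeasurableSpace.comap_sup, MeasurableSpace.comap_comp, ← sup_assoc]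
      exact h
    · rw [hνm]
      exact hinv

/-- An invariant law `m` is close to the law of the conditional law `α` of the state given the
observations after time `a`, if the second moments of `α` are close to those of the conditional law
given all the observations and the states up to time `a`: the filter with law `m` lies between the
two as a martingale. -/
lemma norm_charFunDual_sub_le_of_invariant (hX : ∀ k, Measurable (X k))
    (hY : ∀ k, Measurable (Y k))
    (hstep : ∀ j, IsCondLaw Pr (past Y j ⊔ past X j) (fun w => (X (j + 1) w, Y (j + 1) w))
      fun w => stepProb P Φ (X j w))
    (hinv : Kernel.Invariant (filterKernel P Φ) m) {a b : ℤ} (hab : a ≤ b)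
    (hbary : HasBarycenter m (Pr.map (X a))) {α γ : W → ProbabilityMeasure E}
    (hα : IsCondLaw Pr (window Y a b) (X b) α)
    (hγ : IsCondLaw Pr (past Y b ⊔ past X a) (X b) γ)
    (I : Finset {A : Set E // MeasurableSet A}) (L : StrongDual ℝ (I → ℝ)) :
    ‖charFunDual (m.map (evalOn I)) L - charFunDual ((Pr.map α).map (evalOn I)) L‖ ≤
      ‖L‖ * ∑ i : I, √(∫ w, (γ w : Measure E).real i.1.1 ^ 2 ∂Pr -
        ∫ w, (α w : Measure E).real i.1.1 ^ 2 ∂Pr) := by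
  obtain ⟨ν, hν, hνm⟩ := exists_isCondLaw_coupling hX hY hstep hinv hab hbary
  set Q := coupling m Pr (X a) with hQ
  have hsnd : MeasurePreserving Prod.snd Q Pr := measurePreserving_snd_coupling (hX a) hbary
  have hpast : past Y b ⊔ past X a ≤ mW := sup_le (past_le hY b) (past_le hX a)
  have hwin : window Y a b ≤ mW := (window_le_past Y a b).trans (past_le hY b)
  have hα' := hα.comap hwin hsnd (hX b)
  have hγ' := hγ.coupling (m := m) hpast (hX b) ((measurable_past X le_rfl).mono le_sup_right le_rfl)
    hbary
  have hle : MeasurableSpace.comap Prod.fst inferInstance ⊔ (window Y a b).comap Prod.snd ≤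
      MeasurableSpace.comap (Prod.fst : ProbabilityMeasure E × W → _) inferInstance ⊔
        (past Y b ⊔ past X a).comap Prod.snd :=
    sup_le_sup le_rfl (MeasurableSpace.comap_mono ((window_le_past Y a b).trans le_sup_left))
  have hle' : MeasurableSpace.comap Prod.fst inferInstance ⊔ (past Y b ⊔ past X a).comap Prod.snd ≤
      (inferInstance : MeasurableSpace (ProbabilityMeasure E × W)) :=
    sup_le measurable_fst.comap_le
      ((MeasurableSpace.comap_mono hpast).trans measurable_snd.comap_le)
  have hXb : Measurable fun p : ProbabilityMeasure E × W => X b p.2 := (hX b).comp measurable_snd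
  have hαm : Measurable α := hα.measurable.mono hwin le_rfl
  have hγm : Measurable γ := hγ.measurable.mono hpast le_rfl
  have hνmeas : Measurable ν := hν.measurable.mono (hle.trans hle') le_rfl
  have h := norm_charFunDual_evalOn_sub_le Q (hαm.comp measurable_snd) hνmeas I L
  rw [hνm, ← Measure.map_map hαm measurable_snd, hsnd.map_eq] at h
  refine h.trans (mul_le_mul_of_nonneg_left (Finset.sum_le_sum fun i _ => Real.sqrt_le_sqrt ?_)
    (norm_nonneg _))
  have hsq : ∀ {η : W → ProbabilityMeasure E}, Measurable η →
      ∫ p, (η p.2 : Measure E).real i.1.1 ^ 2 ∂Q = ∫ w, (η w : Measure E).real i.1.1 ^ 2 ∂Pr := by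
    intro η hη
    have hmeas : Measurable fun w => (η w : Measure E).real i.1.1 ^ 2 :=
      (measurable_eval_measure hη i.1.2).ennreal_toReal.pow_const 2
    have h := integral_map (μ := Q) measurable_snd.aemeasurable
      (f := fun w => (η w : Measure E).real i.1.1 ^ 2) hmeas.aestronglyMeasurable
    rw [hsnd.map_eq] at h
    exact h.symm
  have h₁ := hα'.integral_sq_sub hν le_sup_right (hle.trans hle') hXb i.1.2
  have h₂ := hν.integral_sq_sub hγ' hle hle' hXb i.1.2
  have hpos : 0 ≤ ∫ p, ((γ p.2 : Measure E).real i.1.1 - (ν p : Measure E).real i.1.1) ^ 2 ∂Q :=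
    integral_nonneg fun _ => sq_nonneg _
  rw [hsq hγm] at h₂
  have h₃ : ∫ p, ((α ∘ Prod.snd) p : Measure E).real i.1.1 ^ 2 ∂Q
      = ∫ w, (α w : Measure E).real i.1.1 ^ 2 ∂Pr := hsq hαm
  rw [h₃] at h₁
  rw [h₁]
  linarith

end CoupledFilter

section Uniqueness

lemma IsCondLaw.integral_sq_eq {Ω E : Type*} [MeasurableSpace E] {m mΩ : MeasurableSpace Ω}
    {Pr : Measure Ω} [IsProbabilityMeasure Pr] {Z : Ω → E} {ν : Ω → ProbabilityMeasure E}
    (h : IsCondLaw Pr m Z ν) (hm : m ≤ mΩ) (hZ : Measurable Z) {D : Set E} (hD : MeasurableSet D) :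
    ∫ ω, (ν ω : Measure E).real D ^ 2 ∂Pr = ∫ ω, (Pr⟦Z ⁻¹' D | m⟧) ω ^ 2 ∂Pr := by
  refine integral_congr_ae ?_
  filter_upwards [h.ae_eq_condExp hm hZ hD] with ω hω
  rw [← hω]

lemma IsCondLaw.integral_sq_eq_of_comp {Ω Ω' E : Type*} [MeasurableSpace E]
    {m mΩ : MeasurableSpace Ω} {mΩ' : MeasurableSpace Ω'} {Pr : Measure Ω} [IsProbabilityMeasure Pr]
    {Pr' : Measure Ω'} {T : Ω → Ω'} (hT : MeasurePreserving T Pr Pr')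
    {ν : Ω' → ProbabilityMeasure E} (hν : Measurable ν) {Z : Ω → E} (hm : m ≤ mΩ)
    (hZ : Measurable Z) (h : IsCondLaw Pr m Z (ν ∘ T)) {D : Set E} (hD : MeasurableSet D) :
    ∫ w, (ν w : Measure E).real D ^ 2 ∂Pr' = ∫ ω, (Pr⟦Z ⁻¹' D | m⟧) ω ^ 2 ∂Pr := by
  rw [← h.integral_sq_eq hm hZ hD, ← hT.map_eq]
  exact integral_map hT.measurable.aemeasurable
    ((measurable_eval_measure hν hD).ennreal_toReal.pow_const 2).aestronglyMeasurable

variable {Ω E F : Type*} [MeasurableSpace E] [MeasurableSpace F] {mΩ : MeasurableSpace Ω}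
  {Pr : Measure Ω} [IsProbabilityMeasure Pr] {P : Kernel E E} {Φ : Kernel E F}
  {X : ℤ → Ω → E} {Y : ℤ → Ω → F}

/-- Under the exchange identity, the conditional laws of the state given the observations of a
growing time window, and given all the observations together with the states of a receding past,
have the same second moments in the limit. -/
lemma IsStationaryHMM.tendsto_integral_sq_sub (h : IsStationaryHMM Pr P Φ X Y)
    [StandardBorelSpace E] [Nonempty E] (hex : ExchangeIdentity Pr X Y)
    {α γ : ℕ → (ℤ → E × F) → ProbabilityMeasure E}
    (hα : ∀ n : ℕ, IsCondLaw (pathLaw Pr X Y) (window coordY (0 - n) 0) (coordX 0) (α n))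
    (hγ : ∀ n : ℕ, IsCondLaw (pathLaw Pr X Y) (past coordY 0 ⊔ past coordX (0 - n)) (coordX 0) (γ n))
    {A : Set E} (hA : MeasurableSet A) :
    Tendsto (fun n => ∫ w, (γ n w : Measure E).real A ^ 2 ∂pathLaw Pr X Y -
      ∫ w, (α n w : Measure E).real A ^ 2 ∂pathLaw Pr X Y) atTop (𝓝 0) := by
  have hT := h.measurePreserving_path 0
  have hX₀ := h.measurable_X 0
  obtain ⟨ν, hν⟩ := exists_isCondLaw Pr (HMM.past_le h.measurable_Y 0) hX₀
  have hν' : IsCondLaw Pr (tailField X Y 0) (X 0) ν := by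
    refine hν.of_ae_eq (past_le_tailField X Y 0) fun B hB => ?_
    rw [← tailField_zero] at hB
    exact hex.1 B hB
  have htail : tailField X Y 0 ≤ mΩ := (tailField_le X Y 0).trans (h.past_le 0 0)
  have hγ' : ∀ n : ℕ, ∫ w, (γ n w : Measure E).real A ^ 2 ∂pathLaw Pr X Y
      = ∫ ω, (Pr⟦X 0 ⁻¹' A | past Y 0 ⊔ past X (0 - n)⟧) ω ^ 2 ∂Pr := by
    intro n
    have hle : past coordY 0 ⊔ past coordX (0 - n) ≤ MeasurableSpace.pi (X := fun _ : ℤ => E × F) :=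
      sup_le (HMM.past_le measurable_coordY 0) (HMM.past_le measurable_coordX _)
    refine IsCondLaw.integral_sq_eq_of_comp hT ((hγ n).measurable.mono hle le_rfl)
      (h.past_le _ _) hX₀ ?_ hA
    have := (hγ n).comap hle hT (measurable_coordX 0)
    rw [MeasurableSpace.comap_sup, comap_past_shift (coordX_comp_path X Y 0),
      comap_past_shift (coordY_comp_path X Y 0), add_zero, add_zero] at this
    exact this
  have hwin : ∀ n : ℕ, (window coordY (0 - (n : ℤ)) 0).comap (path X Y 0) = window Y (0 - n) 0 := by
    intro n
    simp only [window, MeasurableSpace.comap_iSup, MeasurableSpace.comap_comp, coordY_comp_path,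
      add_zero]
  have hwle : ∀ n : ℕ, window Y (0 - (n : ℤ)) 0 ≤ mΩ := fun n =>
    (window_le_past Y _ 0).trans (HMM.past_le h.measurable_Y 0)
  have hα' : ∀ n : ℕ, ∫ w, (α n w : Measure E).real A ^ 2 ∂pathLaw Pr X Y
      = ∫ ω, (Pr⟦X 0 ⁻¹' A | window Y (0 - n) 0⟧) ω ^ 2 ∂Pr := by
    intro n
    have hle : window coordY (0 - (n : ℤ)) 0 ≤ MeasurableSpace.pi (X := fun _ : ℤ => E × F) :=
      (window_le_past _ _ 0).trans (HMM.past_le measurable_coordY 0)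
    refine IsCondLaw.integral_sq_eq_of_comp hT ((hα n).measurable.mono hle le_rfl)
      (hwle n) hX₀ ?_ hA
    have := (hα n).comap hle hT (measurable_coordX 0)
    rw [hwin] at this
    exact this
  simp only [hγ', hα']
  have hdown := tendsto_integral_sq_condExp (fun n : ℕ => h.past_le 0 (0 - n)) htail (hX₀ hA)
    (tendsto_eLpNorm_condExp_iInf (antitone_past_sup_past X Y 0) (fun n => h.past_le _ _)
      ((memLp_const (μ := Pr) (1 : ℝ)).indicator (hX₀ hA)))
  let ℱ : Filtration ℕ mΩ :=
    { seq := fun n => window Y (0 - n) 0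
      mono' := fun i j hij => window_anti Y 0 (by omega)
      le' := hwle }
  have hup₁ := tendsto_eLpNorm_condExp (μ := Pr) (ℱ := ℱ) ((X 0 ⁻¹' A).indicator fun _ => (1 : ℝ))
  have hsup : ⨆ n, ℱ n = past Y 0 := iSup_window Y 0
  rw [hsup] at hup₁
  have hup := tendsto_integral_sq_condExp hwle (HMM.past_le h.measurable_Y 0) (hX₀ hA) hup₁
  have hlim := hdown.sub hup
  rwa [← hν'.integral_sq_eq htail hX₀ hA, ← hν.integral_sq_eq (HMM.past_le h.measurable_Y 0) hX₀ hA,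
    sub_self] at hlim

variable [IsMarkovKernel P] [IsMarkovKernel Φ]

lemma IsStationaryHMM.isCondLaw_step_pathLaw (h : IsStationaryHMM Pr P Φ X Y) (j : ℤ) :
    IsCondLaw (pathLaw Pr X Y) (past coordY j ⊔ past coordX j)
      (fun w => (coordX (j + 1) w, coordY (j + 1) w)) fun w => stepProb P Φ (coordX j w) := by
  refine IsCondLaw.of_comap (sup_le (HMM.past_le measurable_coordY j)
    (HMM.past_le measurable_coordX j)) (h.measurePreserving_path 0)
    ((measurable_coordX _).prodMk (measurable_coordY _))
    (measurable_stepProb.comp ((measurable_past coordX le_rfl).mono le_sup_right le_rfl)) ?_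
  rw [MeasurableSpace.comap_sup, comap_past_shift (coordX_comp_path X Y 0),
    comap_past_shift (coordY_comp_path X Y 0), add_zero]
  convert h.isCondLaw_step j using 1
  · funext ω
    simp [path, coordX, coordY]
  · funext ω
    simp [path, coordX]

/-- Under the exchange identity, at most one invariant law has the barycenter of the model. -/
lemma IsStationaryHMM.eq_of_invariant [StandardBorelSpace E] [Nonempty E] [StandardBorelSpace F]
    (h : IsStationaryHMM Pr P Φ X Y) (hex : ExchangeIdentity Pr X Y)
    {m₁ m₂ : Measure (ProbabilityMeasure E)} [IsProbabilityMeasure m₁] [IsProbabilityMeasure m₂]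
    (hinv₁ : Kernel.Invariant (filterKernel P Φ) m₁) (hbary₁ : HasBarycenter m₁ (Pr.map (X 0)))
    (hinv₂ : Kernel.Invariant (filterKernel P Φ) m₂) (hbary₂ : HasBarycenter m₂ (Pr.map (X 0))) :
    m₁ = m₂ := by
  have hT := h.measurePreserving_path 0
  have := h.isProbabilityMeasure_pathLaw
  have : Nonempty (ℤ → E × F) := (Measure.nonempty_of_neZero Pr).map (path X Y 0)
  have hwle : ∀ n : ℕ, window coordY (0 - (n : ℤ)) 0 ≤ MeasurableSpace.pi (X := fun _ : ℤ => E × F) :=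
    fun n => (window_le_past _ _ 0).trans (HMM.past_le measurable_coordY 0)
  have hple : ∀ n : ℕ, past coordY 0 ⊔ past coordX (0 - (n : ℤ)) ≤
      MeasurableSpace.pi (X := fun _ : ℤ => E × F) :=
    fun n => sup_le (HMM.past_le measurable_coordY 0) (HMM.past_le measurable_coordX _)
  choose α hα using fun n : ℕ => exists_isCondLaw (pathLaw Pr X Y) (hwle n)
    (measurable_coordX (E := E) (F := F) 0)
  choose γ hγ using fun n : ℕ => exists_isCondLaw (pathLaw Pr X Y) (hple n)
    (measurable_coordX (E := E) (F := F) 0)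
  have hmarg : ∀ a : ℤ, (pathLaw Pr X Y).map (coordX a) = Pr.map (X 0) := by
    intro a
    rw [← hT.map_eq, Measure.map_map (measurable_coordX a) hT.measurable, coordX_comp_path,
      add_zero, h.map_X a]
  have hlim : ∀ (I : Finset {A : Set E // MeasurableSet A}) (L : StrongDual ℝ (I → ℝ))
      {m : Measure (ProbabilityMeasure E)} [IsProbabilityMeasure m],
      Kernel.Invariant (filterKernel P Φ) m → HasBarycenter m (Pr.map (X 0)) →
      Tendsto (fun n => charFunDual (((pathLaw Pr X Y).map (α n)).map (evalOn I)) L) atTop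
        (𝓝 (charFunDual (m.map (evalOn I)) L)) := by
    intro I L m _ hinv hbary
    have hzero : Tendsto (fun n => ‖L‖ * ∑ i : I,
        √(∫ w, (γ n w : Measure E).real i.1.1 ^ 2 ∂pathLaw Pr X Y -
          ∫ w, (α n w : Measure E).real i.1.1 ^ 2 ∂pathLaw Pr X Y)) atTop (𝓝 0) := by
      have := (tendsto_finsetSum Finset.univ fun (i : I) _ =>
        (h.tendsto_integral_sq_sub hex hα hγ i.1.2).sqrt).const_mul ‖L‖
      simpa only [Real.sqrt_zero, Finset.sum_const_zero, mul_zero] using this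
    rw [tendsto_iff_norm_sub_tendsto_zero]
    refine squeeze_zero (fun _ => norm_nonneg _) (fun n => ?_) hzero
    rw [norm_sub_rev]
    exact norm_charFunDual_sub_le_of_invariant measurable_coordX measurable_coordY
      h.isCondLaw_step_pathLaw hinv (by omega) (by rwa [hmarg]) (hα n) (hγ n) I L
  refine ext_of_charFunDual_evalOn fun I => ?_
  ext L
  exact tendsto_nhds_unique (hlim I L hinv₁ hbary₁) (hlim I L hinv₂ hbary₂)

end Uniqueness

/-! ### Exchange of intersection and supremum for conditionally dominated observations -/

section CondProb

variable {Ω : Type*} {m mΩ : MeasurableSpace Ω} {Pr : Measure Ω} [IsFiniteMeasure Pr]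

/-- A version of the conditional probability of an event, with values in `[0, 1]`. -/
lemma exists_condProb (hm : m ≤ mΩ) {S : Set Ω} (hS : MeasurableSet[mΩ] S) :
    ∃ p : Ω → ℝ≥0∞, Measurable[m] p ∧ (∀ ω, p ω ≤ 1) ∧
      (∀ f : Ω → ℝ≥0∞, Measurable[m] f → ∫⁻ ω in S, f ω ∂Pr = ∫⁻ ω, f ω * p ω ∂Pr) ∧
      (fun ω => (p ω).toReal) =ᵐ[Pr] Pr⟦S | m⟧ := by
  have hZ : Measurable fun ω => ω ∈ S := hS.mem
  have hpre : (fun ω => ω ∈ S) ⁻¹' {True} = S := by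
    ext ω
    simp
  obtain ⟨ν, hν⟩ := exists_isCondLaw Pr hm hZ
  refine ⟨fun ω => (ν ω : Measure Prop) {True}, ?_, fun ω => prob_le_one, fun f hf => ?_, ?_⟩
  · exact measurable_eval_measure hν.measurable (MeasurableSet.singleton _)
  · have := hν.lintegral_mul hm hZ hf (MeasurableSet.singleton True)
    rwa [hpre] at this
  · have := hν.ae_eq_condExp hm hZ (MeasurableSet.singleton True)
    rwa [hpre] at this

/-- An event that contains all the mass of its conditional probability given `m` is, up to a null
set, an event of `m`. -/
lemma exists_ae_eq_of_condProb (hm : m ≤ mΩ) {S : Set Ω} (hS : MeasurableSet[mΩ] S) {p : Ω → ℝ≥0∞}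
    (hp : Measurable[m] p) (hp1 : ∀ ω, p ω ≤ 1) (hint : ∫⁻ ω, p ω ∂Pr = Pr S)
    (hmass : ∫⁻ ω in S, p ω ∂Pr = Pr S) : ∃ B, MeasurableSet[m] B ∧ S =ᵐ[Pr] B := by
  have hpm : Measurable p := hp.mono hm le_rfl
  have h1 : ∀ᵐ ω ∂Pr, ω ∈ S → p ω = 1 := by
    have hsub : ∫⁻ ω in S, (1 - p ω) ∂Pr = 0 := by
      rw [lintegral_sub hpm (by rw [hmass]; exact measure_ne_top _ _) (ae_of_all _ hp1), hmass,
        setLIntegral_one, tsub_self]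
    have hmeas : Measurable fun ω => 1 - p ω := measurable_const.sub hpm
    rw [lintegral_eq_zero_iff hmeas] at hsub
    filter_upwards [(ae_restrict_iff' hS).1 hsub] with ω hω hωS
    exact le_antisymm (hp1 ω) (tsub_eq_zero_iff_le.1 (hω hωS))
  have h0 : ∀ᵐ ω ∂Pr, ω ∈ Sᶜ → p ω = 0 := by
    have hcompl : ∫⁻ ω in Sᶜ, p ω ∂Pr = 0 := by
      have := lintegral_add_compl (μ := Pr) p hS
      rw [hint, hmass] at this
      exact (ENNReal.add_right_inj (measure_ne_top Pr S)).1 (this.trans (add_zero _).symm)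
    rw [lintegral_eq_zero_iff hpm] at hcompl
    exact (ae_restrict_iff' hS.compl).1 hcompl
  refine ⟨p ⁻¹' {1}, hp (MeasurableSet.singleton 1), ?_⟩
  refine eventuallyEq_set.2 ?_
  filter_upwards [h0, h1] with ω h0 h1
  constructor
  · exact fun h => h1 h
  · intro h
    by_contra hS
    have h' : p ω = 1 := h
    rw [h0 hS] at h'
    exact zero_ne_one h'

end CondProb

section ProductExchange

variable {Ω F : Type*} [MeasurableSpace F] {m mΩ : MeasurableSpace Ω} {Pr : Measure Ω}
  [IsProbabilityMeasure Pr]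

/-- Under a product measure, the conditional probability of `A × C` given `m ⊗ 𝓑(F)` is the product
of that of `A` given `m` with the indicator of `C`. -/
lemma lintegral_prod_condProb (hm : m ≤ mΩ) (φ : Measure F) [IsFiniteMeasure φ] {A : Set Ω}
    {C : Set F} (hC : MeasurableSet C) {p : Ω → ℝ≥0∞}
    (hp : Measurable[m] p)
    (hpA : ∀ f : Ω → ℝ≥0∞, Measurable[m] f → ∫⁻ ω in A, f ω ∂Pr = ∫⁻ ω, f ω * p ω ∂Pr)
    {g : Ω × F → ℝ≥0∞} (hg : Measurable[m.prod inferInstance] g) :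
    ∫⁻ z in A ×ˢ C, g z ∂Pr.prod φ =
      ∫⁻ z, p z.1 * C.indicator (fun _ => 1) z.2 * g z ∂Pr.prod φ := by
  have hprod : m.prod (inferInstance : MeasurableSpace F) ≤ mΩ.prod inferInstance :=
    sup_le_sup (MeasurableSpace.comap_mono hm) le_rfl
  have hpm : Measurable p := hp.mono hm le_rfl
  have hd : Measurable fun z : Ω × F => p z.1 * C.indicator (fun _ => 1) z.2 :=
    (hpm.comp measurable_fst).mul ((measurable_const.indicator hC).comp measurable_snd)
  refine Eq.trans ?_
    (lintegral_withDensity_eq_lintegral_mul (Pr.prod φ) hd (hg.mono hprod le_rfl))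
  refine lintegral_eq_of_forall_measurableSet hprod (fun S hS => ?_) hg
  refine measure_eq_of_forall_inter (m₁ := m.comap Prod.fst)
    (m₂ := MeasurableSpace.comap Prod.snd inferInstance)
    (le_trans (MeasurableSpace.comap_mono hm) le_sup_left) le_sup_right ?_ hS
  rintro _ _ ⟨A', hA', rfl⟩ ⟨C', hC', rfl⟩
  have hA'm := hm A' hA'
  rw [← Set.prod_eq, Measure.restrict_apply (hA'm.prod hC'), withDensity_apply _ (hA'm.prod hC'),
    Set.prod_inter_prod, Measure.prod_prod, ← Measure.prod_restrict,
    lintegral_prod_mul hpm.aemeasurable (measurable_const.indicator hC).aemeasurable]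
  congr 1
  · have h := hpA (A'.indicator fun _ => 1) (Measurable.indicator (@measurable_const _ _ _ m 1) hA')
    rw [← lintegral_indicator hA'm]
    have h1 : ∫⁻ ω in A, A'.indicator (fun _ => (1 : ℝ≥0∞)) ω ∂Pr = Pr (A' ∩ A) := by
      rw [← Measure.restrict_apply hA'm]
      exact lintegral_indicator_one hA'm
    rw [← h1, h]
    refine lintegral_congr fun ω => ?_
    by_cases hω : ω ∈ A' <;> simp [hω]
  · rw [Set.inter_comm, ← Measure.restrict_apply hC]
    exact (lintegral_indicator_one hC).symm

/-- Under a product measure, `⋂ (𝒢 n ⊗ 𝓑(F)) = (⋂ 𝒢 n) ⊗ 𝓑(F)` up to null sets. -/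
lemma exists_ae_eq_of_measurableSet_iInf_prod {𝒢 : ℕ → MeasurableSpace Ω} (hanti : Antitone 𝒢)
    (hle : ∀ n, 𝒢 n ≤ mΩ) (φ : Measure F) [IsFiniteMeasure φ] {S : Set (Ω × F)}
    (hS : MeasurableSet[⨅ n, (𝒢 n).prod inferInstance] S) :
    ∃ B, MeasurableSet[(⨅ n, 𝒢 n).prod inferInstance] B ∧ S =ᵐ[Pr.prod φ] B := by
  have hprod : ∀ {m : MeasurableSpace Ω}, m ≤ mΩ →
      m.prod (inferInstance : MeasurableSpace F) ≤ mΩ.prod inferInstance := fun hm =>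
    sup_le_sup (MeasurableSpace.comap_mono hm) le_rfl
  have hle' : ⨅ n, 𝒢 n ≤ mΩ := (iInf_le 𝒢 0).trans (hle 0)
  rw [MeasurableSpace.measurableSet_iInf] at hS
  have hSm : MeasurableSet[mΩ.prod inferInstance] S := hprod (hle 0) S (hS 0)
  obtain ⟨p, hp, hp1, hpS, -⟩ := exists_condProb (Pr := Pr.prod φ) (hprod hle') hSm
  have hpm := hp.mono (hprod hle') le_rfl
  -- it suffices that `p` is the conditional probability of `S` given the full product σ-field,
  -- which is tested on rectangles
  have hmass : (Pr.prod φ).restrict S = (Pr.prod φ).withDensity p := by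
    refine Measure.ext fun R hR => ?_
    refine measure_eq_of_forall_inter (m₁ := mΩ.comap Prod.fst)
      (m₂ := MeasurableSpace.comap Prod.snd inferInstance) le_sup_left le_sup_right ?_ hR
    rintro _ _ ⟨A, hA, rfl⟩ ⟨C, hC, rfl⟩
    choose q hq hq1 hqA hqE using fun n => exists_condProb (Pr := Pr) (hle n) hA
    obtain ⟨q', hq', hq'1, hq'A, hq'E⟩ := exists_condProb (Pr := Pr) hle' hA
    rw [← Set.prod_eq, Measure.restrict_apply (hA.prod hC), withDensity_apply _ (hA.prod hC)]
    -- `a` is the conditional probability of `A × C` given `(⨅ n, 𝒢 n) ⊗ 𝓑(F)`; the conditional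
    -- probabilities `b n` given `𝒢 n ⊗ 𝓑(F)` converge to it in `L¹`
    set a : Ω × F → ℝ≥0∞ := fun z => q' z.1 * C.indicator (fun _ => 1) z.2 with ha
    set b : ℕ → Ω × F → ℝ≥0∞ := fun n z => q n z.1 * C.indicator (fun _ => 1) z.2 with hb
    set e : ℕ → Ω → ℝ≥0∞ := fun n ω => ‖(q n ω).toReal - (q' ω).toReal‖ₑ with he
    have hqm : ∀ n, Measurable (q n) := fun n => (hq n).mono (hle n) le_rfl
    have hq'm : Measurable q' := hq'.mono hle' le_rfl
    have hem : ∀ n, Measurable (e n) := fun n =>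
      ((hqm n).ennreal_toReal.sub hq'm.ennreal_toReal).enorm
    have hlim : Tendsto (fun n => ∫⁻ z, e n z.1 ∂Pr.prod φ) atTop (𝓝 0) := by
      have h1 : ∀ n, ∫⁻ z, e n z.1 ∂Pr.prod φ
          = φ Set.univ * eLpNorm (Pr⟦A | 𝒢 n⟧ - Pr⟦A | ⨅ n, 𝒢 n⟧) 1 Pr := by
        intro n
        rw [lintegral_prod (fun z : Ω × F => e n z.1) ((hem n).comp measurable_fst).aemeasurable]
        simp only [lintegral_const]
        rw [lintegral_mul_const _ (hem n), mul_comm, eLpNorm_one_eq_lintegral_enorm]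
        congr 1
        refine lintegral_congr_ae ?_
        filter_upwards [hqE n, hq'E] with ω h1 h2
        simp only [he, Pi.sub_apply]
        rw [h1, h2]
      simp only [h1]
      have := ENNReal.Tendsto.const_mul (a := φ Set.univ) (tendsto_eLpNorm_condExp_iInf hanti hle
        ((memLp_const (μ := Pr) (1 : ℝ)).indicator hA)) (Or.inr (measure_ne_top φ _))
      rwa [mul_zero] at this
    have hab : ∀ n z, b n z ≤ a z + e n z.1 ∧ a z ≤ b n z + e n z.1 := by
      intro n z
      have hfin : q n z.1 ≠ ∞ := ((hq1 n z.1).trans_lt ENNReal.one_lt_top).ne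
      have hfin' : q' z.1 ≠ ∞ := ((hq'1 z.1).trans_lt ENNReal.one_lt_top).ne
      have key : ∀ s t : ℝ, ENNReal.ofReal s ≤ ENNReal.ofReal t + ‖s - t‖ₑ := by
        intro s t
        rw [Real.enorm_eq_ofReal_abs]
        refine le_trans (ENNReal.ofReal_le_ofReal ?_) ENNReal.ofReal_add_le
        linarith [le_abs_self (s - t)]
      have h1 := key (q n z.1).toReal (q' z.1).toReal
      have h2 := key (q' z.1).toReal (q n z.1).toReal
      rw [ENNReal.ofReal_toReal hfin, ENNReal.ofReal_toReal hfin'] at h1 h2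
      rw [← enorm_neg, neg_sub] at h2
      by_cases hz : z.2 ∈ C
      · simpa [ha, hb, he, hz] using And.intro h1 h2
      · simp [ha, hb, hz]
    have ham : Measurable a :=
      (hq'm.comp measurable_fst).mul ((measurable_const.indicator hC).comp measurable_snd)
    have hbm : ∀ n, Measurable (b n) := fun n =>
      ((hqm n).comp measurable_fst).mul ((measurable_const.indicator hC).comp measurable_snd)
    have hbS : ∀ n, ∫⁻ z in S, b n z ∂Pr.prod φ = Pr.prod φ (A ×ˢ C ∩ S) := by
      intro n
      have h := lintegral_prod_condProb (hle n) φ hC (hq n) (hqA n)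
        (Measurable.indicator (@measurable_const _ _ _ ((𝒢 n).prod inferInstance) 1) (hS n))
      have h1 : ∫⁻ z in A ×ˢ C, S.indicator (fun _ => (1 : ℝ≥0∞)) z ∂Pr.prod φ
          = Pr.prod φ (A ×ˢ C ∩ S) := by
        rw [Set.inter_comm, ← Measure.restrict_apply hSm]
        exact lintegral_indicator_one hSm
      rw [← h1, h, ← lintegral_indicator hSm]
      refine lintegral_congr fun z => ?_
      by_cases hz : z ∈ S <;> simp [hb, hz]
    have haS : ∫⁻ z in S, a z ∂Pr.prod φ = ∫⁻ z in A ×ˢ C, p z ∂Pr.prod φ := by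
      rw [lintegral_prod_condProb hle' φ hC hq' hq'A hp]
      refine hpS a (Measurable.mul (hq'.comp (@measurable_fst _ _ (⨅ n, 𝒢 n) _)) ?_)
      exact (measurable_const.indicator hC).comp (@measurable_snd _ _ (⨅ n, 𝒢 n) _)
    rw [← haS]
    have hemS : ∀ n, ∫⁻ z in S, e n z.1 ∂Pr.prod φ ≤ ∫⁻ z, e n z.1 ∂Pr.prod φ := fun n =>
      setLIntegral_le_lintegral _ _
    apply le_antisymm
    · have hT := hlim.const_add (∫⁻ z in S, a z ∂Pr.prod φ)
      rw [add_zero] at hT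
      refine ge_of_tendsto' hT fun n => ?_
      rw [← hbS n]
      refine (lintegral_mono fun z => (hab n z).1).trans ?_
      rw [lintegral_add_left ham]
      exact add_le_add le_rfl (hemS n)
    · have hT := hlim.const_add (Pr.prod φ (A ×ˢ C ∩ S))
      rw [add_zero] at hT
      refine ge_of_tendsto' hT fun n => ?_
      rw [← hbS n]
      refine (lintegral_mono fun z => (hab n z).2).trans ?_
      rw [lintegral_add_left (hbm n)]
      exact add_le_add le_rfl (hemS n)
  refine exists_ae_eq_of_condProb (hprod hle') hSm hp hp1 ?_ ?_
  · have := hpS (fun _ => 1) measurable_const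
    simpa only [setLIntegral_one, one_mul] using this.symm
  · rw [← withDensity_apply _ hSm, ← hmass, Measure.restrict_apply hSm, Set.inter_self]

/-- If the joint law of `(ω, Y ω)` is dominated by a product measure, then
`⋂ (𝒢 n ∨ σ(Y)) = (⋂ 𝒢 n) ∨ σ(Y)` up to null sets. -/
lemma exists_ae_eq_of_measurableSet_iInf_sup {𝒢 : ℕ → MeasurableSpace Ω} (hanti : Antitone 𝒢)
    (hle : ∀ n, 𝒢 n ≤ mΩ) (φ : Measure F) [IsFiniteMeasure φ] {Y : Ω → F}
    (hac : ∀ S, MeasurableSet[(𝒢 0).prod inferInstance] S → Pr.prod φ S = 0 →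
      Pr ((fun ω => (ω, Y ω)) ⁻¹' S) = 0) {A : Set Ω}
    (hA : MeasurableSet[⨅ n, 𝒢 n ⊔ MeasurableSpace.comap Y inferInstance] A) :
    ∃ B, MeasurableSet[(⨅ n, 𝒢 n) ⊔ MeasurableSpace.comap Y inferInstance] B ∧ A =ᵐ[Pr] B := by
  have hcomap : ∀ m : MeasurableSpace Ω, m ⊔ MeasurableSpace.comap Y inferInstance =
      (m.prod inferInstance).comap fun ω => (ω, Y ω) := by
    intro m
    rw [MeasurableSpace.comap_prodMk (mβ := m) (fun ω => ω) Y]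
    congr 1
    exact MeasurableSpace.comap_id.symm
  have hprod : Antitone fun n => (𝒢 n).prod (inferInstance : MeasurableSpace F) :=
    fun i j hij => sup_le_sup (MeasurableSpace.comap_mono (hanti hij)) le_rfl
  rw [iInf_congr fun n => hcomap (𝒢 n), ← comap_iInf_of_antitone hprod] at hA
  rw [hcomap]
  obtain ⟨S, hS, rfl⟩ := hA
  obtain ⟨B, hB, hSB⟩ := exists_ae_eq_of_measurableSet_iInf_prod (Pr := Pr) hanti hle φ hS
  refine ⟨_, ⟨B, hB, rfl⟩, ?_⟩
  have hS₀ := MeasurableSpace.measurableSet_iInf.1 hS 0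
  have hB₀ : MeasurableSet[(𝒢 0).prod inferInstance] B :=
    sup_le_sup (MeasurableSpace.comap_mono (iInf_le 𝒢 0)) le_rfl B hB
  rw [← measure_symmDiff_eq_zero_iff] at hSB ⊢
  exact hac _ (hS₀.symmDiff hB₀) hSB

end ProductExchange

/-! ### The remote past of the hidden states -/

section Tail

lemma setLIntegral_inter_eq {Ω : Type*} {mΩ : MeasurableSpace Ω} {Pr : Measure Ω}
    {B S : Set Ω} (hB : MeasurableSet[mΩ] B) {f : Ω → ℝ≥0∞} :
    ∫⁻ ω in B ∩ S, f ω ∂Pr = ∫⁻ ω in S, f ω * B.indicator (fun _ => 1) ω ∂Pr := by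
  rw [← Measure.restrict_restrict hB, ← lintegral_indicator hB]
  refine lintegral_congr fun ω => ?_
  by_cases hω : ω ∈ B <;> simp [hω]

variable {Ω E F : Type*} [MeasurableSpace E] [MeasurableSpace F] {mΩ : MeasurableSpace Ω}
  {Pr : Measure Ω} [IsProbabilityMeasure Pr] {P : Kernel E E} {Φ : Kernel E F} [IsMarkovKernel P]
  [IsMarkovKernel Φ] {X : ℤ → Ω → E} {Y : ℤ → Ω → F}

/-- The reference measure of a transition density may be taken finite. -/
lemma HasTransitionDensity.exists_dominating {Φ : Kernel E F} (hΦ : HasTransitionDensity Φ) :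
    ∃ φ : Measure F, IsFiniteMeasure φ ∧ ∀ x, Φ x ≪ φ := by
  obtain ⟨φ, hφ, g, -, hg⟩ := hΦ
  refine ⟨φ.toFinite, inferInstance, fun x => ?_⟩
  refine Measure.AbsolutelyContinuous.trans (Measure.AbsolutelyContinuous.mk fun A hA h0 => ?_)
    (absolutelyContinuous_toFinite φ)
  rw [hg x A hA, Measure.restrict_eq_zero.2 h0, lintegral_zero_measure]

lemma stepKernel_observation_eq_zero {φ : Measure F} (hac : ∀ x, Φ x ≪ φ) {C : Set F}
    (hC : MeasurableSet C) (h0 : φ C = 0) (x : E) :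
    stepKernel P Φ x (Prod.snd ⁻¹' C) = 0 := by
  rw [stepKernel, Kernel.compProd_apply (measurable_snd hC)]
  refine (lintegral_congr fun x' => ?_).trans lintegral_zero
  exact hac x' h0

/-- A new observation shifts the tail σ-field by one time step, up to null sets. -/
lemma IsStationaryHMM.exists_ae_eq_of_measurableSet_tailField_succ (h : IsStationaryHMM Pr P Φ X Y)
    (hΦ : HasTransitionDensity Φ) (j : ℤ) {A : Set Ω}
    (hA : MeasurableSet[tailField X Y (j + 1)] A) :
    ∃ B, MeasurableSet[tailField X Y j ⊔ MeasurableSpace.comap (Y (j + 1)) inferInstance] B ∧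
      A =ᵐ[Pr] B := by
  obtain ⟨φ, _, hac⟩ := hΦ.exists_dominating
  refine exists_ae_eq_of_measurableSet_iInf_sup (antitone_past_sup_past X Y j)
    (fun n => h.past_le _ _) φ (Y := Y (j + 1)) (fun S hS h0 => ?_) ?_
  · rw [Nat.cast_zero, sub_zero] at hS
    have hstep := h.isCondLaw_step j
    have hle := h.past_le j j
    have hSm : MeasurableSet[mΩ.prod inferInstance] S :=
      sup_le_sup (MeasurableSpace.comap_mono hle) le_rfl S hS
    have hpair : Measurable fun ω => (ω, Y (j + 1) ω) := measurable_id.prodMk (h.measurable_Y _)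
    have hf : Measurable[(past Y j ⊔ past X j).prod inferInstance]
        fun p : Ω × (E × F) => S.indicator (fun _ => (1 : ℝ≥0∞)) (p.1, p.2.2) := by
      refine Measurable.comp (Measurable.indicator
        (@measurable_const _ _ _ ((past Y j ⊔ past X j).prod inferInstance) 1) hS) ?_
      exact @Measurable.prodMk _ _ Ω F (past Y j ⊔ past X j) _ _ _
        (@measurable_fst Ω (E × F) (past Y j ⊔ past X j) _)
        (measurable_snd.comp (@measurable_snd Ω (E × F) (past Y j ⊔ past X j) _))
    have hint := hstep.lintegral_prod hle ((h.measurable_X _).prodMk (h.measurable_Y _)) hf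
    have hlhs : Pr ((fun ω => (ω, Y (j + 1) ω)) ⁻¹' S)
        = ∫⁻ ω, S.indicator (fun _ => (1 : ℝ≥0∞)) (ω, Y (j + 1) ω) ∂Pr :=
      (lintegral_indicator_one (hpair hSm)).symm
    rw [hlhs, hint]
    rw [Measure.measure_prod_null hSm] at h0
    refine (lintegral_congr_ae ?_).trans lintegral_zero
    filter_upwards [h0] with ω hω
    have hC : MeasurableSet (Prod.mk ω ⁻¹' S) := measurable_prodMk_left hSm
    refine Eq.trans (lintegral_indicator_one (measurable_snd hC)) ?_
    exact stepKernel_observation_eq_zero hac hC hω (X j ω)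
  · rw [MeasurableSpace.measurableSet_iInf] at hA ⊢
    intro n
    refine (?_ : past Y (j + 1) ⊔ past X (j + 1 - (n + 1 : ℕ)) ≤ _) A (hA (n + 1))
    rw [past_succ, show j + 1 - ((n + 1 : ℕ) : ℤ) = j - n by push_cast; ring]
    exact sup_le (sup_le (le_sup_left.trans le_sup_left) le_sup_right)
      (le_sup_right.trans le_sup_left)

lemma tailField_sup_comap_le (X : ℤ → Ω → E) (Y : ℤ → Ω → F) (j : ℤ) :
    tailField X Y j ⊔ MeasurableSpace.comap (Y (j + 1)) inferInstance ≤ tailField X Y (j + 1) := by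
  refine le_iInf fun k => sup_le ?_ (le_sup_of_le_left (comap_le_past Y le_rfl))
  exact (iInf_le _ k).trans (sup_le_sup (past_mono Y (by omega)) (past_mono X (by omega)))

/-- Several new observations shift the tail σ-field accordingly, up to null sets. -/
lemma IsStationaryHMM.exists_ae_eq_of_measurableSet_tailField (h : IsStationaryHMM Pr P Φ X Y)
    (hΦ : HasTransitionDensity Φ) {i j : ℤ} (hij : j ≤ i) {A : Set Ω}
    (hA : MeasurableSet[tailField X Y i] A) :
    ∃ B, MeasurableSet[tailField X Y j ⊔ past Y i] B ∧ A =ᵐ[Pr] B := by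
  induction i, hij using Int.leInduction generalizing A with
  | base => exact ⟨A, (le_sup_left : tailField X Y j ≤ tailField X Y j ⊔ past Y j) A hA, ae_eq_refl _⟩
  | succ i hij ih =>
    obtain ⟨B, hB, hAB⟩ := h.exists_ae_eq_of_measurableSet_tailField_succ hΦ i hA
    have hle : tailField X Y i ⊔ MeasurableSpace.comap (Y (i + 1)) inferInstance ≤
        eventuallyMeasurableSpace (tailField X Y j ⊔ past Y (i + 1)) (ae Pr) := by
      refine sup_le (fun S hS => ?_) ?_
      · obtain ⟨S', hS', hSS'⟩ := ih hS
        exact ⟨S', sup_le_sup le_rfl (past_mono Y (by omega)) S' hS', hSS'⟩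
      · exact ((comap_le_past Y le_rfl).trans le_sup_right).trans
          le_eventuallyMeasurableSpace
    obtain ⟨B', hB', hBB'⟩ := hle B hB
    exact ⟨B', hB', hAB.trans hBB'⟩

/-- If the tail σ-field carries no more information on the present state than the observations, then
it carries none on the states and observations to come. Here `p` is the conditional probability of
the tail event `G`, and conditional independence is expressed by the agreement of the measures
`1_G Pr` and `p Pr` on the σ-field of the later states and observations. -/
lemma IsStationaryHMM.measure_inter_eq_setLIntegral (h : IsStationaryHMM Pr P Φ X Y) {i j : ℤ}
    (hij : j ≤ i) {ν₀ ν₁ : Ω → ProbabilityMeasure E} (hν₀ : IsCondLaw Pr (past Y j) (X j) ν₀)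
    (hν₁ : IsCondLaw Pr (tailField X Y j) (X j) ν₁)
    (hν : ∀ D, MeasurableSet D →
      (fun ω => (ν₀ ω : Measure E) D) =ᵐ[Pr] fun ω => (ν₁ ω : Measure E) D)
    {G : Set Ω} (hG : MeasurableSet[tailField X Y j] G) {p : Ω → ℝ≥0∞} (hp : Measurable[past Y j] p)
    (hpG : ∀ f : Ω → ℝ≥0∞, Measurable[past Y j] f → ∫⁻ ω in G, f ω ∂Pr = ∫⁻ ω, f ω * p ω ∂Pr)
    {W : Set Ω} (hW : MeasurableSet[past Y i ⊔ window X (j - 1) i] W) :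
    Pr.restrict G W = Pr.withDensity p W := by
  have htail : tailField X Y j ≤ mΩ := (tailField_le X Y j).trans (h.past_le j j)
  have hYle : ∀ k, past Y k ≤ mΩ := HMM.past_le h.measurable_Y
  have hpm : Measurable p := hp.mono (hYle j) le_rfl
  induction i, hij using Int.leInduction generalizing W with
  | base =>
    have hwin : window X (j - 1) j = MeasurableSpace.comap (X j) inferInstance := by
      have := window_succ X (le_refl (j - 1))
      rwa [sub_add_cancel, window_self, bot_sup_eq] at this
    rw [hwin] at hW
    refine measure_eq_of_forall_inter (hYle j) (h.measurable_X j).comap_le ?_ hW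
    rintro B _ hB ⟨D, hD, rfl⟩
    have hBm := hYle j B hB
    have hBD : MeasurableSet[mΩ] (B ∩ X j ⁻¹' D) := hBm.inter (h.measurable_X j hD)
    have hBind : Measurable[past Y j] (B.indicator fun _ => (1 : ℝ≥0∞)) :=
      Measurable.indicator (@measurable_const _ _ _ (past Y j) 1) hB
    rw [Measure.restrict_apply hBD, withDensity_apply _ hBD]
    have h1 : Pr (B ∩ X j ⁻¹' D ∩ G)
        = ∫⁻ ω in G, B.indicator (fun _ => 1) ω * (ν₀ ω : Measure E) D ∂Pr := by
      rw [Set.inter_right_comm, hν₁.measure_inter (B ∩ G) D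
        ((past_le_tailField X Y j B hB).inter hG) hD, ← Measure.restrict_restrict hBm,
        ← lintegral_indicator hBm]
      refine lintegral_congr_ae (ae_restrict_of_ae ?_)
      filter_upwards [hν D hD] with ω hω
      by_cases hωB : ω ∈ B <;> simp [hωB, hω]
    have h2 := hν₀.lintegral_mul (hYle j) (h.measurable_X j) (hp.mul hBind) hD
    rw [h1, setLIntegral_inter_eq hBm]
    refine (hpG _ (hBind.mul (measurable_eval_measure hν₀.measurable hD))).trans
      (Eq.trans (lintegral_congr fun ω => ?_) h2.symm)
    simp only [Pi.mul_apply]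
    ring
  | succ i hij ih =>
    set Z : Ω → E × F := fun ω => (X (i + 1) ω, Y (i + 1) ω) with hZ
    have hZm : Measurable Z := (h.measurable_X _).prodMk (h.measurable_Y _)
    have hle : past Y i ⊔ window X (j - 1) i ≤ past Y i ⊔ past X i :=
      sup_le_sup le_rfl (window_le_past X _ _)
    have hsup : past Y (i + 1) ⊔ window X (j - 1) (i + 1) =
        (past Y i ⊔ window X (j - 1) i) ⊔ MeasurableSpace.comap Z inferInstance := by
      rw [past_succ, window_succ X (by omega : j - 1 ≤ i), hZ]
      rw [show MeasurableSpace.comap (fun ω => (X (i + 1) ω, Y (i + 1) ω)) inferInstance =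
        MeasurableSpace.comap (X (i + 1)) inferInstance ⊔
          MeasurableSpace.comap (Y (i + 1)) inferInstance from MeasurableSpace.comap_prodMk _ _]
      rw [sup_sup_sup_comm, sup_comm (MeasurableSpace.comap (Y (i + 1)) _)]
    rw [hsup] at hW
    have hmΩ := h.past_le i i
    refine measure_eq_of_forall_inter (hle.trans hmΩ) hZm.comap_le ?_ hW
    rintro B _ hB ⟨D, hD, rfl⟩
    have hBm := hmΩ B (hle B hB)
    have hBD : MeasurableSet[mΩ] (B ∩ Z ⁻¹' D) := hBm.inter (hZm hD)
    rw [Measure.restrict_apply hBD, withDensity_apply _ hBD]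
    have hstep := h.isCondLaw_step i
    have hGi : MeasurableSet[past Y i ⊔ past X i] G :=
      sup_le_sup (past_mono Y hij) (past_mono X hij) G (tailField_le X Y j G hG)
    have hpi : Measurable[past Y i ⊔ past X i] p :=
      hp.mono ((past_mono Y hij).trans le_sup_left) le_rfl
    set s : Ω → ℝ≥0∞ := fun ω => B.indicator (fun _ => 1) ω * stepKernel P Φ (X i ω) D with hs
    have hXi : Measurable[past Y i ⊔ window X (j - 1) i] (X i) := by
      refine measurable_iff_comap_le.2 (le_sup_of_le_right ?_)
      exact le_iSup₂_of_le i ⟨by omega, le_rfl⟩ le_rfl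
    have hsm : Measurable[past Y i ⊔ window X (j - 1) i] s :=
      (Measurable.indicator (@measurable_const _ _ _ (past Y i ⊔ window X (j - 1) i) 1) hB).mul
        ((Kernel.measurable_coe _ hD).comp hXi)
    have h1 : Pr (B ∩ Z ⁻¹' D ∩ G) = ∫⁻ ω, s ω ∂Pr.restrict G := by
      rw [Set.inter_right_comm, hstep.measure_inter (B ∩ G) D ((hle B hB).inter hGi) hD,
        ← Measure.restrict_restrict hBm, ← lintegral_indicator hBm]
      refine lintegral_congr fun ω => ?_
      by_cases hωB : ω ∈ B <;> simp [hs, hωB, stepProb]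
    have hBp : Measurable[past Y i ⊔ past X i] fun ω => p ω * B.indicator (fun _ => 1) ω :=
      hpi.mul (Measurable.indicator (@measurable_const _ _ _ (past Y i ⊔ past X i) 1) (hle B hB))
    have h2 := hstep.lintegral_mul hmΩ hZm hBp hD
    rw [h1, lintegral_eq_of_forall_measurableSet (hle.trans hmΩ) (fun A hA => ih hA) hsm,
      lintegral_withDensity_eq_lintegral_mul _ hpm (hsm.mono (hle.trans hmΩ) le_rfl),
      setLIntegral_inter_eq hBm]
    refine Eq.trans (lintegral_congr fun ω => ?_) h2.symm
    simp only [Pi.mul_apply, hs, mul_assoc]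
    rfl

/-- If, at all times, the tail σ-field carries no more information on the present state than the
observations, then the exchange identity holds. -/
lemma IsStationaryHMM.exchangeIdentity (h : IsStationaryHMM Pr P Φ X Y)
    (hΦ : HasTransitionDensity Φ)
    (hcond : ∀ j, ∃ ν₀ ν₁ : Ω → ProbabilityMeasure E, IsCondLaw Pr (past Y j) (X j) ν₀ ∧
      IsCondLaw Pr (tailField X Y j) (X j) ν₁ ∧ ∀ D, MeasurableSet D →
        (fun ω => (ν₀ ω : Measure E) D) =ᵐ[Pr] fun ω => (ν₁ ω : Measure E) D) :
    ExchangeIdentity Pr X Y := by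
  have hYle : past Y 0 ≤ mΩ := HMM.past_le h.measurable_Y 0
  have htail : ∀ j, tailField X Y j ≤ mΩ := fun j => (tailField_le X Y j).trans (h.past_le j j)
  rw [ExchangeIdentity, tailField_zero]
  refine ⟨fun S hS => ?_, fun B hB => ⟨B, past_le_tailField X Y 0 B hB, ae_eq_refl _⟩⟩
  have hSm := htail 0 S hS
  obtain ⟨q, hq, hq1, hqS, -⟩ := exists_condProb (Pr := Pr) hYle hSm
  -- conditional independence of the tail σ-field and the states after time `-n`
  have key : ∀ n : ℕ, ∀ W, MeasurableSet[past Y 0 ⊔ window X (0 - n) 0] W →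
      Pr.restrict S W = Pr.withDensity q W := by
    intro n W hW
    have hWm : MeasurableSet[mΩ] W :=
      (sup_le_sup le_rfl (window_le_past X _ 0)).trans (h.past_le 0 0) W hW
    obtain ⟨w, hw, hw1, hwW, -⟩ := exists_condProb (Pr := Pr) hYle hWm
    have hwm : Measurable w := hw.mono hYle le_rfl
    set j : ℤ := 0 - n with hj
    have hj0 : j ≤ 0 := by omega
    obtain ⟨ν₀, ν₁, hν₀, hν₁, hν⟩ := hcond j
    -- the conditional probability `w` of `W` given the observations is also the one given the tail
    -- σ-field at time `j` and the observations, and `S` belongs to the latter up to a null set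
    have hgen : ∀ T, MeasurableSet[tailField X Y j ⊔ past Y 0] T →
        Pr.restrict W T = Pr.withDensity w T := by
      intro T hT
      refine measure_eq_of_forall_inter (htail j) hYle ?_ hT
      intro G B hG hB
      have hGm := htail j G hG
      have hBm := hYle B hB
      obtain ⟨p, hp, hp1, hpG, -⟩ :=
        exists_condProb (Pr := Pr) (HMM.past_le h.measurable_Y j) hGm
      have hp' : Measurable[past Y 0] p := hp.mono (past_mono Y hj0) le_rfl
      have hpm : Measurable p := hp'.mono hYle le_rfl
      have hmeas : ∀ R, MeasurableSet[past Y 0 ⊔ window X (j - 1) 0] R →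
          Pr.restrict G R = Pr.withDensity p R := fun R hR =>
        h.measure_inter_eq_setLIntegral hj0 hν₀ hν₁ hν hG hp hpG hR
      have hle : past Y 0 ⊔ window X (j - 1) 0 ≤ mΩ :=
        (sup_le_sup le_rfl (window_le_past X _ 0)).trans (h.past_le 0 0)
      have hWB : MeasurableSet[past Y 0 ⊔ window X (j - 1) 0] (W ∩ B) :=
        MeasurableSet.inter (sup_le_sup le_rfl (window_anti X 0 (by omega)) W hW)
          ((le_sup_left : past Y 0 ≤ past Y 0 ⊔ window X (j - 1) 0) B hB)
      have hBind : Measurable[past Y 0] (B.indicator fun _ => (1 : ℝ≥0∞)) :=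
        Measurable.indicator (@measurable_const _ _ _ (past Y 0) 1) hB
      have hwB : Measurable[past Y 0] fun ω => w ω * B.indicator (fun _ => 1) ω := hw.mul hBind
      rw [Measure.restrict_apply (hGm.inter hBm), withDensity_apply _ (hGm.inter hBm)]
      have h1 : Pr (G ∩ B ∩ W) = ∫⁻ ω, p ω * B.indicator (fun _ => 1) ω * w ω ∂Pr := by
        rw [show G ∩ B ∩ W = W ∩ B ∩ G by
          rw [Set.inter_assoc, Set.inter_comm, Set.inter_comm B W],
          ← Measure.restrict_apply (hWm.inter hBm), hmeas _ hWB,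
          withDensity_apply _ (hWm.inter hBm), Set.inter_comm, setLIntegral_inter_eq hBm]
        exact hwW _ (hp'.mul hBind)
      have h2 : ∫⁻ ω in G ∩ B, w ω ∂Pr = ∫⁻ ω, p ω * (w ω * B.indicator (fun _ => 1) ω) ∂Pr := by
        rw [Set.inter_comm, setLIntegral_inter_eq hBm,
          lintegral_eq_of_forall_measurableSet hle hmeas (hwB.mono le_sup_left le_rfl)]
        exact lintegral_withDensity_eq_lintegral_mul _ hpm (hwB.mono hYle le_rfl)
      rw [h1, h2]
      exact lintegral_congr fun ω => by ring
    obtain ⟨T, hT, hST⟩ := h.exists_ae_eq_of_measurableSet_tailField hΦ hj0 hS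
    have hTm : MeasurableSet[mΩ] T := sup_le (htail j) hYle T hT
    have h3 : Pr (W ∩ S) = ∫⁻ ω in S, w ω ∂Pr := by
      have hWS : (W ∩ S : Set Ω) =ᵐ[Pr] (W ∩ T : Set Ω) := (ae_eq_refl W).inter hST
      rw [measure_congr hWS, Measure.restrict_congr_set hST, ← withDensity_apply _ hTm,
        ← hgen T hT, Measure.restrict_apply hTm, Set.inter_comm]
    rw [Measure.restrict_apply hWm, withDensity_apply _ hWm, h3, hqS w hw, hwW q hq]
    exact lintegral_congr fun ω => mul_comm _ _
  -- letting `n → ∞`, `S` is conditionally independent of itself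
  have hmono : Monotone fun n : ℕ => past Y 0 ⊔ window X (0 - n) 0 :=
    fun a b hab => sup_le_sup le_rfl (window_anti X 0 (by omega))
  have hSsup : MeasurableSet[⨆ n : ℕ, past Y 0 ⊔ window X (0 - n) 0] S := by
    rw [← sup_iSup, iSup_window]
    exact tailField_le X Y 0 S hS
  have hmass := measure_eq_of_forall_iSup hmono
    (fun n => (sup_le_sup le_rfl (window_le_past X _ 0)).trans (h.past_le 0 0)) key hSsup
  rw [Measure.restrict_apply hSm, Set.inter_self, withDensity_apply _ hSm] at hmass
  refine exists_ae_eq_of_condProb hYle hSm hq hq1 ?_ hmass.symm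
  have := hqS (fun _ => 1) measurable_const
  simpa only [setLIntegral_one, one_mul] using this.symm

variable [StandardBorelSpace E] [Nonempty E] [MeasurableSpace.CountablyGenerated F]

/-- The law of the conditional law of the state given the tail σ-field is invariant. -/
lemma IsStationaryHMM.invariant_tailField (h : IsStationaryHMM Pr P Φ X Y)
    (hΦ : HasTransitionDensity Φ) {ν : (ℤ → E × F) → ProbabilityMeasure E}
    (hν : IsCondLaw (pathLaw Pr X Y) (tailField coordX coordY 0) (coordX 0) ν) :
    Kernel.Invariant (filterKernel P Φ) ((pathLaw Pr X Y).map ν) := by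
  have h₀ : (tailField coordX coordY 0).comap (path X Y 0) = tailField X Y 0 :=
    comap_tailField_shift (coordX_comp_path X Y 0) (coordY_comp_path X Y 0) 0
  have h₁ : (tailField coordX coordY 0).comap (path X Y 1) = tailField X Y (0 + 1) :=
    comap_tailField_shift (coordX_comp_path X Y 1) (coordY_comp_path X Y 1) 0
  refine h.invariant (h.measurePreserving_path 0) (h.measurePreserving_path 1)
    (measurable_coordX 0) rfl rfl ((tailField_le _ _ 0).trans
      (sup_le (HMM.past_le measurable_coordY 0) (HMM.past_le measurable_coordX 0))) ?_ ?_ ?_ hν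
  · rw [h₀]
    exact tailField_le X Y 0
  · rw [h₀, h₁]
    exact tailField_sup_comap_le X Y 0
  · rw [h₀, h₁]
    exact fun B hB => h.exists_ae_eq_of_measurableSet_tailField_succ hΦ 0 hB

end Tail

end HMM

theorem theorem1p1 {E F Ω : Type*}
    [TopologicalSpace E] [PolishSpace E] [MeasurableSpace E] [BorelSpace E] [Nonempty E]
    [TopologicalSpace F] [PolishSpace F] [MeasurableSpace F] [BorelSpace F]
    [MeasurableSpace Ω] (Pr : Measure Ω) [IsProbabilityMeasure Pr]
    (P : Kernel E E) [IsMarkovKernel P] (Φ : Kernel E F) [IsMarkovKernel Φ]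
    (X : ℤ → Ω → E) (Y : ℤ → Ω → F) (hXY : HMM.IsStationaryHMM Pr P Φ X Y)
    (μ : Measure E) (hμ : Pr.map (X 0) = μ) :
    (HMM.ExchangeIdentity Pr X Y →
      ∃! m : ProbabilityMeasure (ProbabilityMeasure E),
        Kernel.Invariant (HMM.filterKernel P Φ) (m : Measure (ProbabilityMeasure E)) ∧
          HMM.HasBarycenter (m : Measure (ProbabilityMeasure E)) μ) ∧
    (HMM.HasTransitionDensity Φ →
      (∃! m : ProbabilityMeasure (ProbabilityMeasure E),
        Kernel.Invariant (HMM.filterKernel P Φ) (m : Measure (ProbabilityMeasure E)) ∧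
          HMM.HasBarycenter (m : Measure (ProbabilityMeasure E)) μ) →
      HMM.ExchangeIdentity Pr X Y) := by
  open HMM in
  subst hμ
  have := hXY.isProbabilityMeasure_pathLaw
  have hbary : Pr.map (X 0) = (pathLaw Pr X Y).map (coordX 0) := by
    rw [← (hXY.measurePreserving_path 0).map_eq,
      Measure.map_map (measurable_coordX 0) (hXY.measurePreserving_path 0).measurable]
    rfl
  have hle₀ : past coordY 0 ≤ MeasurableSpace.pi (X := fun _ : ℤ => E × F) :=
    HMM.past_le measurable_coordY 0
  have hle₁ : tailField coordX coordY 0 ≤ MeasurableSpace.pi (X := fun _ : ℤ => E × F) :=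
    (tailField_le _ _ 0).trans (sup_le hle₀ (HMM.past_le measurable_coordX 0))
  obtain ⟨ν₀, hν₀⟩ := exists_isCondLaw (pathLaw Pr X Y) hle₀ (measurable_coordX (E := E) (F := F) 0)
  have hν₀m : Measurable ν₀ := hν₀.measurable.mono hle₀ le_rfl
  have hm₀ : IsProbabilityMeasure ((pathLaw Pr X Y).map ν₀) :=
    Measure.isProbabilityMeasure_map hν₀m.aemeasurable
  have hbary₀ := hν₀.hasBarycenter hle₀ (measurable_coordX 0)
  rw [← hbary] at hbary₀
  refine ⟨fun hex => ⟨⟨_, hm₀⟩, ⟨hXY.invariant_past hν₀, hbary₀⟩, fun m hm => ?_⟩,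
    fun hΦ huniq => ?_⟩
  · obtain ⟨m, hmp⟩ := m
    exact Subtype.ext
      (hXY.eq_of_invariant (m₁ := m) hex hm.1 hm.2 (hXY.invariant_past hν₀) hbary₀)
  · obtain ⟨ν₁, hν₁⟩ :=
      exists_isCondLaw (pathLaw Pr X Y) hle₁ (measurable_coordX (E := E) (F := F) 0)
    have hν₁m : Measurable ν₁ := hν₁.measurable.mono hle₁ le_rfl
    have hm₁ : IsProbabilityMeasure ((pathLaw Pr X Y).map ν₁) :=
      Measure.isProbabilityMeasure_map hν₁m.aemeasurable
    have hbary₁ := hν₁.hasBarycenter hle₁ (measurable_coordX 0)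
    rw [← hbary] at hbary₁
    have hlaw : (pathLaw Pr X Y).map ν₀ = (pathLaw Pr X Y).map ν₁ :=
      congrArg Subtype.val (huniq.unique
        (y₁ := (⟨_, hm₀⟩ : ProbabilityMeasure (ProbabilityMeasure E)))
        (y₂ := (⟨_, hm₁⟩ : ProbabilityMeasure (ProbabilityMeasure E)))
        ⟨hXY.invariant_past hν₀, hbary₀⟩ ⟨hXY.invariant_tailField hΦ hν₁, hbary₁⟩)
    refine hXY.exchangeIdentity hΦ fun j => ⟨ν₀ ∘ path X Y j, ν₁ ∘ path X Y j, ?_, ?_, ?_⟩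
    · have := hν₀.comap hle₀ (hXY.measurePreserving_path j) (measurable_coordX 0)
      rwa [comap_past_shift (coordY_comp_path X Y j), coordX_comp_path, zero_add] at this
    · have := hν₁.comap hle₁ (hXY.measurePreserving_path j) (measurable_coordX 0)
      rwa [comap_tailField_shift (coordX_comp_path X Y j) (coordY_comp_path X Y j),
        coordX_comp_path, zero_add] at this
    · intro D hD
      exact (hXY.measurePreserving_path j).quasiMeasurePreserving.ae_eq_comp
        (hν₀.ae_eq_of_map_eq hν₁ (past_le_tailField coordX coordY 0) hle₁ (measurable_coordX 0)
          hlaw hD)
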